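/- Let $E_1, E_2, F$ be real Banach lattices such that the dual Banach lattices $E_1^*$ and $E_2^*$ have order continuous norms, and let $A\colon E_1\times E_2\to F$ be a positive bilinear operator (that is, $A(x,y)\ge 0$ whenever $x,y\ge 0$; such an operator is automatically continuous) that is almost Dunford-Pettis. Here a bilinear operator $B\colon X\times Y\to G$, with $X,Y$ Banach lattices and $G$ a Banach space, is called almost Dunford-Pettis if $\|B(x_n,y_n)\|\to 0$ whenever $(x_n)$ and $(y_n)$ are disjoint weakly null sequences in $X$ and $Y$, respectively. Suppose that at least one of the following two conditions holds: (i) $F^*$ has the dual positive Schur property, that is, every positive weak$^*$-null sequence in $F^{**}=(F^*)^*$ is norm null; (ii) every positive disjoint norm bounded sequence in $F^*$ is order bounded. Then both Aron-Berner extensions $E_1^{**}\times E_2^{**}\to F^{**}$ of $A$, namely $$(x^{**},y^{**})\mapsto\Big(\varphi\mapsto y^{**}\big(y\mapsto x^{**}(x\mapsto \varphi(A(x,y)))\big)\Big)\quad\text{and}\quad (x^{**},y^{**})\mapsto\Big(\varphi\mapsto x^{**}\big(x\mapsto y^{**}(y\mapsto \varphi(A(x,y)))\big)\Big)\qquad(\varphi\in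 F^*),$$ are weakly positively limited and almost Dunford-Pettis. Here $B\colon E_1^{**}\times E_2^{**}\to F^{**}$ is called weakly positively limited if $\|B(x_n^{**},y_n^{**})\|\to 0$ whenever $(x_n^{**})$ and $(y_n^{**})$ are positive sequences in $E_1^{**}$ and $E_2^{**}$, one of which is weak$^*$-null (with respect to $E_1^*$, respectively $E_2^*$) while the other one is norm bounded. -/

import Mathlib

open Filter Topology

set_option maxSynthPendingDepth 6

noncomputable section

namespace BanachLattice

/-! A (real) Banach lattice is, throughout, a type `E` with the instances
`[NormedAddCommGroup E] [NormedSpace ℝ E] [CompleteSpace E]` (a real Banach space),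
`[Lattice E] [IsOrderedAddMonoid E] [IsOrderedModule ℝ E]` (a vector lattice) and
`[HasSolidNorm E]` (`|x| ≤ |y|` implies `‖x‖ ≤ ‖y‖`). -/

/-! ### The dual Banach lattice -/

section Dual

variable {E : Type*} [NormedAddCommGroup E] [NormedSpace ℝ E] [Lattice E]
  [IsOrderedAddMonoid E] [HasSolidNorm E]

theorem norm_le_of_nonneg_of_le {x y : E} (hx : 0 ≤ x) (hxy : x ≤ y) : ‖x‖ ≤ ‖y‖ := by
  apply norm_le_norm_of_abs_le_abs
  rwa [abs_of_nonneg hx, abs_of_nonneg (hx.trans hxy)]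

/-- The value `f⁺(x) = sup {f y : 0 ≤ y ≤ x}` of the positive part of `f` at `x ≥ 0`. -/
def dualPosAux (f : StrongDual ℝ E) (x : E) : ℝ := sSup (f '' Set.Icc 0 x)

theorem dualPosAux_bddAbove (f : StrongDual ℝ E) (x : E) : BddAbove (f '' Set.Icc 0 x) := by
  refine ⟨‖f‖ * ‖x‖, ?_⟩
  rintro _ ⟨y, hy, rfl⟩
  exact (le_abs_self _).trans ((f.le_opNorm y).trans
    (mul_le_mul_of_nonneg_left (norm_le_of_nonneg_of_le hy.1 hy.2) (norm_nonneg f)))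

theorem le_dualPosAux (f : StrongDual ℝ E) {x y : E} (h0 : 0 ≤ y) (h : y ≤ x) :
    f y ≤ dualPosAux f x :=
  le_csSup (dualPosAux_bddAbove f x) ⟨y, ⟨h0, h⟩, rfl⟩

theorem dualPosAux_le (f : StrongDual ℝ E) {x : E} (hx : 0 ≤ x) {c : ℝ}
    (h : ∀ y, 0 ≤ y → y ≤ x → f y ≤ c) : dualPosAux f x ≤ c := by
  refine csSup_le ⟨f 0, 0, ⟨le_rfl, hx⟩, rfl⟩ ?_
  rintro _ ⟨y, hy, rfl⟩
  exact h y hy.1 hy.2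

theorem dualPosAux_nonneg (f : StrongDual ℝ E) {x : E} (hx : 0 ≤ x) : 0 ≤ dualPosAux f x := by
  simpa using le_dualPosAux f le_rfl hx

theorem dualPosAux_le_norm (f : StrongDual ℝ E) {x : E} (hx : 0 ≤ x) :
    dualPosAux f x ≤ ‖f‖ * ‖x‖ :=
  dualPosAux_le f hx fun y h0 h => (le_abs_self _).trans ((f.le_opNorm y).trans
    (mul_le_mul_of_nonneg_left (norm_le_of_nonneg_of_le h0 h) (norm_nonneg f)))

theorem dualPosAux_add (f : StrongDual ℝ E) {x y : E} (hx : 0 ≤ x) (hy : 0 ≤ y) :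
    dualPosAux f (x + y) = dualPosAux f x + dualPosAux f y := by
  apply le_antisymm
  · refine dualPosAux_le f (add_nonneg hx hy) fun z h0 h => ?_
    have h1 : z = z ⊓ x + (z - z ⊓ x) := by abel
    have h2 : z - z ⊓ x ≤ y := by
      rw [sub_inf, sub_self]
      exact sup_le hy (sub_le_iff_le_add'.2 h)
    rw [h1, map_add]
    exact add_le_add (le_dualPosAux f (le_inf h0 hx) inf_le_right)
      (le_dualPosAux f (sub_nonneg.2 inf_le_left) h2)
  · rw [← le_sub_iff_add_le]
    refine dualPosAux_le f hx fun u hu0 hu => ?_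
    rw [le_sub_comm]
    refine dualPosAux_le f hy fun v hv0 hv => ?_
    rw [le_sub_iff_add_le', ← map_add]
    exact le_dualPosAux f (add_nonneg hu0 hv0) (add_le_add hu hv)

/-- The positive part `f⁺` of a functional, `f⁺(x) = sup {f y : 0 ≤ y ≤ x}` for `x ≥ 0`. -/
def dualPos (f : StrongDual ℝ E) : StrongDual ℝ E :=
  AddMonoidHom.toRealLinearMap
    (AddMonoidHom.mk' (fun x : E => dualPosAux f x⁺ - dualPosAux f x⁻) (by
      intro x y
      have h : (x + y)⁺ + (x⁻ + y⁻) = x⁺ + y⁺ + (x + y)⁻ := by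
        have h1 := posPart_sub_negPart (x + y)
        have h2 := posPart_sub_negPart x
        have h3 := posPart_sub_negPart y
        rw [← sub_eq_zero]
        calc _ = ((x + y)⁺ - (x + y)⁻) - (x⁺ - x⁻) - (y⁺ - y⁻) := by abel
          _ = 0 := by rw [h1, h2, h3]; abel
      have h' := congrArg (dualPosAux f) h
      have p : ∀ z : E, 0 ≤ z⁺ := posPart_nonneg
      have n : ∀ z : E, 0 ≤ z⁻ := negPart_nonneg
      rw [dualPosAux_add f (p _) (add_nonneg (n _) (n _)), dualPosAux_add f (n _) (n _),
        dualPosAux_add f (add_nonneg (p _) (p _)) (n _), dualPosAux_add f (p _) (p _)] at h'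
      linarith))
    (AddMonoidHomClass.continuous_of_bound _ ‖f‖ (by
      intro x
      have e1 : ‖x⁺‖ ≤ ‖x‖ := by
        rw [← norm_abs_eq_norm x, ← posPart_add_negPart]
        exact norm_le_of_nonneg_of_le (posPart_nonneg x)
          (le_add_of_nonneg_right (negPart_nonneg x))
      have e2 : ‖x⁻‖ ≤ ‖x‖ := by
        rw [← norm_abs_eq_norm x, ← posPart_add_negPart]
        exact norm_le_of_nonneg_of_le (negPart_nonneg x)
          (le_add_of_nonneg_left (posPart_nonneg x))
      have a1 := dualPosAux_nonneg f (posPart_nonneg x)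
      have a2 := dualPosAux_nonneg f (negPart_nonneg x)
      have b1 := (dualPosAux_le_norm f (posPart_nonneg x)).trans
        (mul_le_mul_of_nonneg_left e1 (norm_nonneg f))
      have b2 := (dualPosAux_le_norm f (negPart_nonneg x)).trans
        (mul_le_mul_of_nonneg_left e2 (norm_nonneg f))
      change |dualPosAux f x⁺ - dualPosAux f x⁻| ≤ ‖f‖ * ‖x‖
      rw [abs_le]
      constructor <;> linarith))

theorem dualPos_apply (f : StrongDual ℝ E) {x : E} (hx : 0 ≤ x) :
    dualPos f x = sSup (f '' Set.Icc 0 x) := by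
  change dualPosAux f x⁺ - dualPosAux f x⁻ = dualPosAux f x
  have h0 : dualPosAux f (0 : E) = 0 :=
    le_antisymm (by simpa using dualPosAux_le_norm f (le_refl (0 : E)))
      (dualPosAux_nonneg f le_rfl)
  rw [posPart_of_nonneg hx, negPart_of_nonneg hx, h0, sub_zero]

/-- The dual `E*` of a Banach lattice, ordered by `f ≤ g` iff `f x ≤ g x` for all `x ≥ 0`. Its
lattice operations are derived from the Riesz-Kantorovich formula for the positive part. -/
instance instLatticeDual : Lattice (StrongDual ℝ E) where
  le f g := ∀ x : E, 0 ≤ x → f x ≤ g x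
  le_refl f x _ := le_rfl
  le_trans f g h hfg hgh x hx := (hfg x hx).trans (hgh x hx)
  le_antisymm f g hfg hgf := by
    ext x
    have h : ∀ y : E, 0 ≤ y → f y = g y := fun y hy => le_antisymm (hfg y hy) (hgf y hy)
    rw [← posPart_sub_negPart x, map_sub, map_sub, h _ (posPart_nonneg x),
      h _ (negPart_nonneg x)]
  sup f g := g + dualPos (f - g)
  le_sup_left f g x hx := by
    have := le_dualPosAux (f - g) hx le_rfl
    rw [_root_.add_apply, dualPos_apply _ hx]
    simp only [dualPosAux] at this
    rw [_root_.sub_apply] at this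
    linarith
  le_sup_right f g x hx := by
    have := dualPosAux_nonneg (f - g) hx
    rw [_root_.add_apply, dualPos_apply _ hx]
    simp only [dualPosAux] at this
    linarith
  sup_le f g h hf hg x hx := by
    have : dualPosAux (f - g) x ≤ h x - g x := by
      refine dualPosAux_le _ hx fun y h0 hy => ?_
      have h1 := hf y h0
      have h2 := hg (x - y) (sub_nonneg.2 hy)
      simp only [map_sub, _root_.sub_apply] at h2 ⊢
      linarith
    rw [_root_.add_apply, dualPos_apply _ hx]
    simp only [dualPosAux] at this
    linarith
  inf f g := f - dualPos (f - g)
  inf_le_left f g x hx := by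
    have := dualPosAux_nonneg (f - g) hx
    rw [_root_.sub_apply, dualPos_apply _ hx]
    simp only [dualPosAux] at this
    linarith
  inf_le_right f g x hx := by
    have := le_dualPosAux (f - g) hx le_rfl
    rw [_root_.sub_apply, dualPos_apply _ hx]
    simp only [dualPosAux] at this
    rw [_root_.sub_apply] at this
    linarith
  le_inf h f g hf hg x hx := by
    have : dualPosAux (f - g) x ≤ f x - h x := by
      refine dualPosAux_le _ hx fun y h0 hy => ?_
      have h1 := hg y h0
      have h2 := hf (x - y) (sub_nonneg.2 hy)
      simp only [map_sub, _root_.sub_apply] at h2 ⊢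
      linarith
    rw [_root_.sub_apply, dualPos_apply _ hx]
    simp only [dualPosAux] at this
    linarith

theorem dual_le_iff {f g : StrongDual ℝ E} : f ≤ g ↔ ∀ x : E, 0 ≤ x → f x ≤ g x := Iff.rfl

theorem dual_nonneg_iff {f : StrongDual ℝ E} : 0 ≤ f ↔ ∀ x : E, 0 ≤ x → 0 ≤ f x := Iff.rfl

instance instIsOrderedAddMonoidDual : IsOrderedAddMonoid (StrongDual ℝ E) where
  add_le_add_left f g h k x hx := by
    simpa only [_root_.add_apply] using add_le_add_left (h x hx) (k x)

instance instIsOrderedModuleDual : IsOrderedModule ℝ (StrongDual ℝ E) where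
  smul_le_smul_of_nonneg_left a ha f g h x hx := by
    simpa only [_root_.smul_apply, smul_eq_mul] using
      mul_le_mul_of_nonneg_left (h x hx) ha
  smul_le_smul_of_nonneg_right f hf a b hab x hx := by
    simpa only [_root_.smul_apply, smul_eq_mul] using
      mul_le_mul_of_nonneg_right hab (hf x hx)

theorem abs_apply_le_dual_abs (f : StrongDual ℝ E) (x : E) : |f x| ≤ |f| |x| := by
  have hp := posPart_nonneg x
  have hn := negPart_nonneg x
  have h1 := le_abs_self f _ hp
  have h2 := le_abs_self f _ hn
  have h3 := neg_le_abs f _ hp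
  have h4 := neg_le_abs f _ hn
  simp only [_root_.neg_apply] at h3 h4
  rw [← posPart_add_negPart x, map_add]
  have h5 : f x = f x⁺ - f x⁻ := by rw [← map_sub, posPart_sub_negPart]
  rw [h5, abs_le]
  constructor <;> linarith

theorem dual_abs_apply_le (f : StrongDual ℝ E) {x : E} (hx : 0 ≤ x) :
    |f| x ≤ ‖f‖ * ‖x‖ := by
  have h : |f| x = -f x + dualPosAux (f - -f) x := by
    rw [dualPosAux, ← dualPos_apply _ hx]
    rfl
  have : dualPosAux (f - -f) x ≤ ‖f‖ * ‖x‖ + f x := by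
    refine dualPosAux_le _ hx fun y h0 hy => ?_
    have h1 : ‖y - (x - y)‖ ≤ ‖x‖ := by
      apply norm_le_norm_of_abs_le_abs
      rw [abs_of_nonneg hx]
      refine abs_le'.2 ⟨?_, ?_⟩
      · exact (sub_le_self _ (sub_nonneg.2 hy)).trans hy
      · rw [neg_sub]
        exact (sub_le_self _ h0).trans (sub_le_self _ h0)
    have h2 := (le_abs_self _).trans ((f.le_opNorm (y - (x - y))).trans
      (mul_le_mul_of_nonneg_left h1 (norm_nonneg f)))
    simp only [map_sub, _root_.sub_apply, _root_.neg_apply] at h2 ⊢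
    linarith
  linarith

instance instHasSolidNormDual : HasSolidNorm (StrongDual ℝ E) where
  solid f g h := by
    refine f.opNorm_le_bound (norm_nonneg g) fun x => ?_
    have h1 := h |x| (abs_nonneg x)
    have h2 := dual_abs_apply_le g (abs_nonneg x)
    rw [norm_abs_eq_norm] at h2
    exact (abs_apply_le_dual_abs f x).trans (h1.trans h2)

end Dual

/-! ### Classes of sequences and of Banach lattices -/

section Notions

/-- Pairwise disjoint sequences: `|x n| ⊓ |x m| = 0` whenever `n ≠ m`. -/
def DisjointSeq {E : Type*} [Lattice E] [AddCommGroup E] (x : ℕ → E) : Prop :=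
  ∀ n m, n ≠ m → |x n| ⊓ |x m| = 0

/-- Weakly null sequences in a normed space. -/
def WeaklyNull {E : Type*} [NormedAddCommGroup E] [NormedSpace ℝ E] (x : ℕ → E) : Prop :=
  ∀ f : StrongDual ℝ E, Tendsto (fun n => f (x n)) atTop (𝓝 0)

/-- Weak* null sequences in the dual of a normed space. -/
def WeakStarNull {E : Type*} [NormedAddCommGroup E] [NormedSpace ℝ E]
    (f : ℕ → StrongDual ℝ E) : Prop :=
  ∀ x : E, Tendsto (fun n => f n x) atTop (𝓝 0)

/-- Norm bounded sequences. -/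
def NormBoundedSeq {E : Type*} [NormedAddCommGroup E] (x : ℕ → E) : Prop :=
  ∃ C : ℝ, ∀ n, ‖x n‖ ≤ C

/-- Order bounded sequences: those contained in some order interval `[a, b]`. -/
def OrderBoundedSeq {E : Type*} [Lattice E] (x : ℕ → E) : Prop :=
  ∃ a b : E, ∀ n, a ≤ x n ∧ x n ≤ b

/-- The norm of `E` is order continuous: every downward directed set with infimum `0`
contains elements of arbitrarily small norm. (As the norm is monotone on the positive cone, this
says that every net decreasing to `0` is norm null.) -/
def OrderContinuousNorm (E : Type*) [NormedAddCommGroup E] [Lattice E] : Prop :=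
  ∀ D : Set E, D.Nonempty → DirectedOn (fun x y => y ≤ x) D → IsGLB D 0 →
    ∀ ε : ℝ, 0 < ε → ∃ x ∈ D, ‖x‖ < ε

/-- `E` has the dual positive Schur property: positive weak* null sequences in `E*` are norm
null. -/
def DualPositiveSchur (E : Type*) [NormedAddCommGroup E] [NormedSpace ℝ E] [Lattice E]
    [IsOrderedAddMonoid E] [HasSolidNorm E] : Prop :=
  ∀ f : ℕ → StrongDual ℝ E, (∀ n, 0 ≤ f n) → WeakStarNull f →
    Tendsto (fun n => ‖f n‖) atTop (𝓝 0)

end Notions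

/-! ### Bilinear operators -/

section Bilinear

/-- A bilinear operator between ordered vector spaces is positive if `A x y ≥ 0` for all
`x, y ≥ 0`. -/
def IsPositiveBilinear {X Y Z : Type*} [AddCommGroup X] [Module ℝ X] [Lattice X]
    [AddCommGroup Y] [Module ℝ Y] [Lattice Y] [AddCommGroup Z] [Module ℝ Z] [Lattice Z]
    (A : X →ₗ[ℝ] Y →ₗ[ℝ] Z) : Prop :=
  ∀ x y, 0 ≤ x → 0 ≤ y → 0 ≤ A x y

/-- A bilinear operator is almost Dunford-Pettis if it sends pairs of disjoint weakly null
sequences to norm null sequences. -/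
def AlmostDunfordPettis {X Y G : Type*} [NormedAddCommGroup X] [NormedSpace ℝ X] [Lattice X]
    [NormedAddCommGroup Y] [NormedSpace ℝ Y] [Lattice Y] [NormedAddCommGroup G] [NormedSpace ℝ G]
    (A : X →ₗ[ℝ] Y →ₗ[ℝ] G) : Prop :=
  ∀ (x : ℕ → X) (y : ℕ → Y), DisjointSeq x → WeaklyNull x → DisjointSeq y → WeaklyNull y →
    Tendsto (fun n => ‖A (x n) (y n)‖) atTop (𝓝 0)

/-- A bilinear operator `A : X* × Y* → G` is weakly positively limited if `A (f n) (g n)` is norm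
null whenever one of the sequences `f`, `g` is positive and weak* null and the other one is
positive and norm bounded. -/
def WeaklyPositivelyLimited {X Y G : Type*}
    [NormedAddCommGroup X] [NormedSpace ℝ X] [Lattice X] [IsOrderedAddMonoid X] [HasSolidNorm X]
    [NormedAddCommGroup Y] [NormedSpace ℝ Y] [Lattice Y] [IsOrderedAddMonoid Y] [HasSolidNorm Y]
    [NormedAddCommGroup G] [NormedSpace ℝ G]
    (A : StrongDual ℝ X →ₗ[ℝ] StrongDual ℝ Y →ₗ[ℝ] G) : Prop :=
  ∀ (f : ℕ → StrongDual ℝ X) (g : ℕ → StrongDual ℝ Y), (∀ n, 0 ≤ f n) → (∀ n, 0 ≤ g n) →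
    (WeakStarNull f ∧ NormBoundedSeq g) ∨ (NormBoundedSeq f ∧ WeakStarNull g) →
    Tendsto (fun n => ‖A (f n) (g n)‖) atTop (𝓝 0)

/-- Positive bilinear operators on Banach lattices are bounded. -/
theorem IsPositiveBilinear.exists_bound {X Y Z : Type*}
    [NormedAddCommGroup X] [NormedSpace ℝ X] [CompleteSpace X] [Lattice X]
    [IsOrderedAddMonoid X] [IsOrderedModule ℝ X] [HasSolidNorm X]
    [NormedAddCommGroup Y] [NormedSpace ℝ Y] [CompleteSpace Y] [Lattice Y]
    [IsOrderedAddMonoid Y] [IsOrderedModule ℝ Y] [HasSolidNorm Y]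
    [NormedAddCommGroup Z] [NormedSpace ℝ Z] [Lattice Z] [IsOrderedAddMonoid Z] [HasSolidNorm Z]
    {A : X →ₗ[ℝ] Y →ₗ[ℝ] Z} (hA : IsPositiveBilinear A) :
    ∃ C : ℝ, ∀ x y, ‖A x y‖ ≤ C * ‖x‖ * ‖y‖ := by
  have mono : ∀ {x x' : X} {y y' : Y}, 0 ≤ x → x ≤ x' → 0 ≤ y → y ≤ y' →
      ‖A x y‖ ≤ ‖A x' y'‖ := by
    intro x x' y y' hx hxx hy hyy
    refine norm_le_of_nonneg_of_le (hA x y hx hy) ?_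
    have h1 := hA (x' - x) y (sub_nonneg.2 hxx) hy
    have h2 := hA x' (y' - y) (hx.trans hxx) (sub_nonneg.2 hyy)
    rw [map_sub, LinearMap.sub_apply, sub_nonneg] at h1
    rw [map_sub, sub_nonneg] at h2
    exact h1.trans h2
  -- boundedness on pairs of positive unit vectors
  have key : ∃ C : ℝ, 0 ≤ C ∧ ∀ x y, 0 ≤ x → 0 ≤ y → ‖x‖ ≤ 1 → ‖y‖ ≤ 1 → ‖A x y‖ ≤ C := by
    by_contra hcon
    push Not at hcon
    have hex : ∀ n : ℕ, ∃ x : X, ∃ y : Y, 0 ≤ x ∧ 0 ≤ y ∧ ‖x‖ ≤ 1 ∧ ‖y‖ ≤ 1 ∧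
        (n : ℝ) * 4 ^ n < ‖A x y‖ := fun n => hcon _ (by positivity)
    choose u v hu hv hu1 hv1 huv using hex
    have sx : Summable fun n => (1 / 2 : ℝ) ^ n • u n := by
      refine Summable.of_norm_bounded summable_geometric_two fun n => ?_
      rw [norm_smul, Real.norm_of_nonneg (by positivity)]
      exact mul_le_of_le_one_right (by positivity) (hu1 n)
    have sy : Summable fun n => (1 / 2 : ℝ) ^ n • v n := by
      refine Summable.of_norm_bounded summable_geometric_two fun n => ?_
      rw [norm_smul, Real.norm_of_nonneg (by positivity)]
      exact mul_le_of_le_one_right (by positivity) (hv1 n)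
    have px : ∀ n, 0 ≤ (1 / 2 : ℝ) ^ n • u n := fun n => smul_nonneg (by positivity) (hu n)
    have py : ∀ n, 0 ≤ (1 / 2 : ℝ) ^ n • v n := fun n => smul_nonneg (by positivity) (hv n)
    obtain ⟨n, hn⟩ := exists_nat_gt
      ‖A (∑' n, (1 / 2 : ℝ) ^ n • u n) (∑' n, (1 / 2 : ℝ) ^ n • v n)‖
    have h := mono (px n) (sx.le_tsum n fun j _ => px j) (py n) (sy.le_tsum n fun j _ => py j)
    rw [map_smul, map_smul, LinearMap.smul_apply, smul_smul, norm_smul,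
      Real.norm_of_nonneg (by positivity), ← mul_pow] at h
    have h4 : ((1 / 2 : ℝ) * (1 / 2)) ^ n * 4 ^ n = 1 := by
      rw [← mul_pow]; norm_num
    have h5 : (n : ℝ) < ((1 / 2 : ℝ) * (1 / 2)) ^ n * ‖A (u n) (v n)‖ := by
      calc (n : ℝ) = ((1 / 2 : ℝ) * (1 / 2)) ^ n * (n * 4 ^ n) := by
            rw [mul_left_comm, h4, mul_one]
        _ < _ := mul_lt_mul_of_pos_left (huv n) (by positivity)
    linarith
  obtain ⟨C, hC0, hC⟩ := key
  have pos : ∀ x y, 0 ≤ x → 0 ≤ y → ‖A x y‖ ≤ C * ‖x‖ * ‖y‖ := by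
    intro x y hx hy
    rcases eq_or_ne x 0 with rfl | hx0
    · simp
    rcases eq_or_ne y 0 with rfl | hy0
    · simp
    have nx := norm_pos_iff.2 hx0
    have ny := norm_pos_iff.2 hy0
    have h := hC (‖x‖⁻¹ • x) (‖y‖⁻¹ • y) (smul_nonneg (by positivity) hx)
      (smul_nonneg (by positivity) hy) (by rw [norm_smul]; simp [nx.ne'])
      (by rw [norm_smul]; simp [ny.ne'])
    rw [map_smul, map_smul, LinearMap.smul_apply, norm_smul, norm_smul, norm_inv, norm_inv,
      norm_norm, norm_norm, inv_mul_le_iff₀ ny, inv_mul_le_iff₀ nx] at h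
    linarith
  refine ⟨C, fun x y => ?_⟩
  have hb : ‖A x y‖ ≤ ‖A |x| |y|‖ := by
    apply norm_le_norm_of_abs_le_abs
    have e1 := hA _ _ (posPart_nonneg x) (posPart_nonneg y)
    have e2 := hA _ _ (posPart_nonneg x) (negPart_nonneg y)
    have e3 := hA _ _ (negPart_nonneg x) (posPart_nonneg y)
    have e4 := hA _ _ (negPart_nonneg x) (negPart_nonneg y)
    have h1 : A x y = (A x⁺ y⁺ + A x⁻ y⁻) - (A x⁺ y⁻ + A x⁻ y⁺) := by
      conv_lhs => rw [← posPart_sub_negPart x, ← posPart_sub_negPart y]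
      simp only [map_sub, LinearMap.sub_apply]
      abel
    have h2 : A |x| |y| = (A x⁺ y⁺ + A x⁻ y⁻) + (A x⁺ y⁻ + A x⁻ y⁺) := by
      rw [← posPart_add_negPart x, ← posPart_add_negPart y]
      simp only [map_add, LinearMap.add_apply]
      abel
    rw [abs_of_nonneg (hA _ _ (abs_nonneg x) (abs_nonneg y)), h1, h2]
    have p1 := add_nonneg e1 e4
    have p2 := add_nonneg e2 e3
    refine abs_le'.2 ⟨?_, ?_⟩
    · exact (sub_le_self _ p2).trans (le_add_of_nonneg_right p2)
    · rw [neg_sub]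
      exact (sub_le_self _ p1).trans (le_add_of_nonneg_left p1)
  have := pos _ _ (abs_nonneg x) (abs_nonneg y)
  rw [norm_abs_eq_norm, norm_abs_eq_norm] at this
  exact hb.trans this

/-- A positive bilinear operator on Banach lattices, as a continuous bilinear operator. -/
def IsPositiveBilinear.toContinuous {X Y Z : Type*}
    [NormedAddCommGroup X] [NormedSpace ℝ X] [CompleteSpace X] [Lattice X]
    [IsOrderedAddMonoid X] [IsOrderedModule ℝ X] [HasSolidNorm X]
    [NormedAddCommGroup Y] [NormedSpace ℝ Y] [CompleteSpace Y] [Lattice Y]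
    [IsOrderedAddMonoid Y] [IsOrderedModule ℝ Y] [HasSolidNorm Y]
    [NormedAddCommGroup Z] [NormedSpace ℝ Z] [Lattice Z] [IsOrderedAddMonoid Z] [HasSolidNorm Z]
    {A : X →ₗ[ℝ] Y →ₗ[ℝ] Z} (hA : IsPositiveBilinear A) : X →L[ℝ] Y →L[ℝ] Z :=
  A.mkContinuousOfExistsBound₂ hA.exists_bound

theorem IsPositiveBilinear.toContinuous_apply {X Y Z : Type*}
    [NormedAddCommGroup X] [NormedSpace ℝ X] [CompleteSpace X] [Lattice X]
    [IsOrderedAddMonoid X] [IsOrderedModule ℝ X] [HasSolidNorm X]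
    [NormedAddCommGroup Y] [NormedSpace ℝ Y] [CompleteSpace Y] [Lattice Y]
    [IsOrderedAddMonoid Y] [IsOrderedModule ℝ Y] [HasSolidNorm Y]
    [NormedAddCommGroup Z] [NormedSpace ℝ Z] [Lattice Z] [IsOrderedAddMonoid Z] [HasSolidNorm Z]
    {A : X →ₗ[ℝ] Y →ₗ[ℝ] Z} (hA : IsPositiveBilinear A) (x : X) (y : Y) :
    hA.toContinuous x y = A x y := rfl

end Bilinear

/-! ### Aron-Berner extensions of bilinear operators -/

section AronBerner

variable {X Y Z : Type*} [NormedAddCommGroup X] [NormedSpace ℝ X]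
  [NormedAddCommGroup Y] [NormedSpace ℝ Y] [NormedAddCommGroup Z] [NormedSpace ℝ Z]

/-- The Arens adjoint `A* : Z* × X → Y*` of `A : X × Y → Z`, `A*(φ, x)(y) = φ (A (x, y))`. -/
def arensAdjoint (A : X →L[ℝ] Y →L[ℝ] Z) : StrongDual ℝ Z →L[ℝ] X →L[ℝ] StrongDual ℝ Y :=
  ((ContinuousLinearMap.compL ℝ Y Z ℝ).flip ∘L A).flip

theorem arensAdjoint_apply (A : X →L[ℝ] Y →L[ℝ] Z) (φ : StrongDual ℝ Z) (x : X) (y : Y) :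
    arensAdjoint A φ x y = φ (A x y) := rfl

/-- The third Arens adjoint `A*** : X** × Y** → Z**`, that is
`A***(u, v)(φ) = u (x ↦ v (y ↦ φ (A (x, y))))`. -/
def arensTriple (A : X →L[ℝ] Y →L[ℝ] Z) :
    StrongDual ℝ (StrongDual ℝ X) →L[ℝ] StrongDual ℝ (StrongDual ℝ Y) →L[ℝ]
      StrongDual ℝ (StrongDual ℝ Z) :=
  arensAdjoint (arensAdjoint (arensAdjoint A))

/-- The Aron-Berner extension of a continuous bilinear operator `A : X × Y → Z` with respect to a
permutation `ρ` of the two variables, the variable `ρ 0` being extended first: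
`(u, v) ↦ (φ ↦ v (y ↦ u (x ↦ φ (A (x, y)))))` if `ρ` is the identity, and
`(u, v) ↦ (φ ↦ u (x ↦ v (y ↦ φ (A (x, y)))))` if `ρ` is the transposition. -/
def aronBerner (ρ : Equiv.Perm (Fin 2)) (A : X →L[ℝ] Y →L[ℝ] Z) :
    StrongDual ℝ (StrongDual ℝ X) →L[ℝ] StrongDual ℝ (StrongDual ℝ Y) →L[ℝ]
      StrongDual ℝ (StrongDual ℝ Z) :=
  if ρ 0 = 0 then (arensTriple A.flip).flip else arensTriple A

theorem aronBerner_one_apply (A : X →L[ℝ] Y →L[ℝ] Z) (u : StrongDual ℝ (StrongDual ℝ X))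
    (v : StrongDual ℝ (StrongDual ℝ Y)) (φ : StrongDual ℝ Z) :
    ∃ g : StrongDual ℝ Y, (∀ y, ∃ f : StrongDual ℝ X, (∀ x, f x = φ (A x y)) ∧ g y = u f) ∧
      aronBerner 1 A u v φ = v g :=
  ⟨arensAdjoint (arensAdjoint A.flip) u φ,
    fun y => ⟨arensAdjoint A.flip φ y, fun _ => rfl, rfl⟩, rfl⟩

theorem aronBerner_swap_apply (A : X →L[ℝ] Y →L[ℝ] Z) (u : StrongDual ℝ (StrongDual ℝ X))
    (v : StrongDual ℝ (StrongDual ℝ Y)) (φ : StrongDual ℝ Z) :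
    ∃ f : StrongDual ℝ X, (∀ x, ∃ g : StrongDual ℝ Y, (∀ y, g y = φ (A x y)) ∧ f x = v g) ∧
      aronBerner (Equiv.swap 0 1) A u v φ = u f :=
  ⟨arensAdjoint (arensAdjoint A) v φ,
    fun x => ⟨arensAdjoint A φ x, fun _ => rfl, rfl⟩, rfl⟩

end AronBerner

end BanachLattice

end

open BanachLattice

namespace BanachLattice

/-! ### Disjointness in lattice ordered groups -/

section LatticeGroup

variable {E : Type*} [AddCommGroup E] [Lattice E] [IsOrderedAddMonoid E]

/-! Let `B` be either extension. Both alternatives on `F` give the dual positive Schur property of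
`F*`: the second does so by `dualPositiveSchur_of_orderBounded`. Since `B` is positive, it therefore
suffices to show that `B (u n) (v n)` is weak* null, and it is enough to test this on each positive
`φ` in `F*`. This reduces weak positive limitedness to the scalar form `a = φ ∘ A` on `E₁ × E₂`.

Suppose that `u` is weak* null, `v` is bounded, and the extended form stays above some `ε` along a
subsequence. Goldstine's theorem for the positive cone (`exists_nonneg_approx_bidual`) replaces the
bidual elements by bounded positive `x n`, `y n` in the original lattices, with `a (x n) (y n)`
bounded below and `a (x n) (y i) → 0` for each fixed `i`. `exists_disjointSeq_of_tendsto`, applied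
to the functionals `a (x n)`, replaces `y` by a disjoint sequence `w` below it. As `E₂*` has order
continuous norm, `w` is weakly null (`OrderContinuousNorm.weaklyNull`), so now `a (x i) (w n) → 0`
for fixed `i`, and the same argument in the other variable makes `x` disjoint. The result is a pair
of disjoint weakly null sequences on which `a` stays away from zero, contradicting the almost
Dunford-Pettis property of `A`.

The almost Dunford-Pettis property of `B` follows: the moduli of disjoint weakly null sequences are
weakly null, hence weak* null in a dual, and `B` is dominated by its values on moduli. -/

theorem add_inf_le_inf_add_inf {x y w : E} (hx : 0 ≤ x) (hw : 0 ≤ w) (hy : 0 ≤ y) :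
    (x + y) ⊓ w ≤ x ⊓ w + y ⊓ w := by
  set z := (x + y) ⊓ w with hz
  have hz0 : 0 ≤ z := le_inf (add_nonneg hx hy) hw
  have h1 : z - z ⊓ x ≤ y := by
    rw [sub_inf, sub_self]
    exact sup_le hy (sub_le_iff_le_add'.2 inf_le_left)
  have h2 : z - z ⊓ x ≤ w := (sub_le_self _ (le_inf hz0 hx)).trans inf_le_right
  have h3 : z ⊓ x ≤ x ⊓ w := le_inf inf_le_right (inf_le_left.trans inf_le_right)
  calc z = z ⊓ x + (z - z ⊓ x) := by abel
    _ ≤ _ := add_le_add h3 (le_inf h1 h2)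

theorem inf_add_eq_zero {a b c : E} (ha : 0 ≤ a) (hb : 0 ≤ b) (hc : 0 ≤ c)
    (hab : a ⊓ b = 0) (hac : a ⊓ c = 0) : a ⊓ (b + c) = 0 := by
  refine le_antisymm ?_ (le_inf ha (add_nonneg hb hc))
  have := add_inf_le_inf_add_inf hb ha hc
  rwa [inf_comm b, inf_comm c, hab, hac, add_zero, inf_comm] at this

theorem inf_sum_eq_zero {ι : Type*} {a : E} {b : ι → E} {s : Finset ι} (ha : 0 ≤ a)
    (hb : ∀ i ∈ s, 0 ≤ b i) (h : ∀ i ∈ s, a ⊓ b i = 0) : a ⊓ ∑ i ∈ s, b i = 0 := by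
  classical
  induction s using Finset.induction_on with
  | empty => simpa using ha
  | insert i s his ih =>
    rw [Finset.sum_insert his]
    refine inf_add_eq_zero ha (hb i (Finset.mem_insert_self i s))
      (Finset.sum_nonneg fun j hj => hb j (Finset.mem_insert_of_mem hj))
      (h i (Finset.mem_insert_self i s))
      (ih (fun j hj => hb j (Finset.mem_insert_of_mem hj))
        fun j hj => h j (Finset.mem_insert_of_mem hj))

theorem inf_nsmul_eq_zero {a b : E} (n : ℕ) (ha : 0 ≤ a) (hb : 0 ≤ b) (h : a ⊓ b = 0) :
    a ⊓ n • b = 0 := by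
  have := inf_sum_eq_zero (s := Finset.range n) (b := fun _ => b) ha (fun _ _ => hb) fun _ _ => h
  simpa using this

/-- The increasing sequence `N (x₀ + ⋯ + x_{N-1})`, which generates the same ideal as `x`. -/
def seqHull (x : ℕ → E) (N : ℕ) : E := N • ∑ n ∈ Finset.range N, x n

theorem seqHull_nonneg {x : ℕ → E} (hx : ∀ n, 0 ≤ x n) (N : ℕ) : 0 ≤ seqHull x N :=
  nsmul_nonneg (Finset.sum_nonneg fun i _ => hx i) N

theorem sum_range_mono {x : ℕ → E} (hx : ∀ n, 0 ≤ x n) {N M : ℕ} (h : N ≤ M) :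
    ∑ n ∈ Finset.range N, x n ≤ ∑ n ∈ Finset.range M, x n :=
  Finset.sum_le_sum_of_subset_of_nonneg (Finset.range_mono h) fun i _ _ => hx i

theorem seqHull_mono {x : ℕ → E} (hx : ∀ n, 0 ≤ x n) : Monotone (seqHull x) := fun N _ h =>
  (nsmul_le_nsmul_right (sum_range_mono hx h) N).trans
    (nsmul_le_nsmul_left (Finset.sum_nonneg fun i _ => hx i) h)

/-- This is the reason for the factor `N` in `seqHull`: absorbing sums of two terms makes the limit
functional in `exists_component` superadditive. -/
theorem seqHull_add_self_le {x : ℕ → E} (hx : ∀ n, 0 ≤ x n) (N : ℕ) :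
    seqHull x N + seqHull x N ≤ seqHull x (N + N) := by
  rw [seqHull, ← add_nsmul]
  exact nsmul_le_nsmul_right (sum_range_mono hx (Nat.le_add_right N N)) _

theorem seqHull_le_seqHull {x y : ℕ → E} (h : ∀ n, x n ≤ y n) (N : ℕ) :
    seqHull x N ≤ seqHull y N :=
  nsmul_le_nsmul_right (Finset.sum_le_sum fun i _ => h i) N

theorem le_seqHull {x : ℕ → E} (hx : ∀ n, 0 ≤ x n) {n N : ℕ} (h : n < N) : x n ≤ seqHull x N := by
  have h1 : x n ≤ ∑ i ∈ Finset.range N, x i :=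
    Finset.single_le_sum (fun i _ => hx i) (Finset.mem_range.2 h)
  refine h1.trans (le_self_nsmul (Finset.sum_nonneg fun i _ => hx i) (by omega))

theorem inf_seqHull_eq_zero {x : ℕ → E} (hx : ∀ n, 0 ≤ x n) {a : E} (ha : 0 ≤ a)
    (h : ∀ n, a ⊓ x n = 0) (N : ℕ) : a ⊓ seqHull x N = 0 :=
  inf_nsmul_eq_zero N ha (Finset.sum_nonneg fun i _ => hx i)
    (inf_sum_eq_zero ha (fun i _ => hx i) fun i _ => h i)

theorem inf_eq_zero_of_le {a b a' b' : E} (ha : 0 ≤ a) (hb : 0 ≤ b) (haa : a ≤ a') (hbb : b ≤ b')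
    (h : a' ⊓ b' = 0) : a ⊓ b = 0 :=
  le_antisymm ((inf_le_inf haa hbb).trans h.le) (le_inf ha hb)

theorem DisjointSeq.inf_eq_zero {x : ℕ → E} (h : DisjointSeq x) (hx : ∀ n, 0 ≤ x n) {n m : ℕ}
    (hnm : n ≠ m) : x n ⊓ x m = 0 := by
  simpa only [abs_of_nonneg (hx _)] using h n m hnm

theorem DisjointSeq.comp {x : ℕ → E} (h : DisjointSeq x) {φ : ℕ → ℕ}
    (hφ : Function.Injective φ) : DisjointSeq (x ∘ φ) :=
  fun _ _ hnm => h _ _ (hφ.ne hnm)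

end LatticeGroup

/-! ### Positive functionals -/

section Functionals

variable {E : Type*} [NormedAddCommGroup E] [NormedSpace ℝ E] [Lattice E]
  [IsOrderedAddMonoid E] [HasSolidNorm E]

theorem dual_mono {f : StrongDual ℝ E} (hf : 0 ≤ f) {x y : E} (h : x ≤ y) : f x ≤ f y := by
  have := hf (y - x) (sub_nonneg.2 h)
  rw [map_sub] at this
  simpa using this

/-- A bounded additive function on the positive cone extends to a functional. -/
theorem exists_dual_eq_of_additive {p : E → ℝ} {C : ℝ}
    (hadd : ∀ x y, 0 ≤ x → 0 ≤ y → p (x + y) = p x + p y) (h0 : ∀ x, 0 ≤ x → 0 ≤ p x)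
    (hC : ∀ x, 0 ≤ x → p x ≤ C * ‖x‖) : ∃ g : StrongDual ℝ E, ∀ x, 0 ≤ x → g x = p x := by
  have hz : p 0 = 0 := by
    have := hadd 0 0 le_rfl le_rfl
    rw [add_zero] at this
    linarith
  have hC' : ∀ x, 0 ≤ x → p x ≤ |C| * ‖x‖ := fun x hx =>
    (hC x hx).trans (mul_le_mul_of_nonneg_right (le_abs_self C) (norm_nonneg x))
  refine ⟨AddMonoidHom.toRealLinearMap
    (AddMonoidHom.mk' (fun x : E => p x⁺ - p x⁻) ?_)
    (AddMonoidHomClass.continuous_of_bound _ |C| ?_), fun x hx => ?_⟩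
  · intro x y
    have h : (x + y)⁺ + (x⁻ + y⁻) = x⁺ + y⁺ + (x + y)⁻ := by
      rw [← sub_eq_zero]
      calc _ = ((x + y)⁺ - (x + y)⁻) - (x⁺ - x⁻) - (y⁺ - y⁻) := by abel
        _ = 0 := by rw [posPart_sub_negPart, posPart_sub_negPart, posPart_sub_negPart]; abel
    have h' := congrArg p h
    have hp : ∀ z : E, 0 ≤ z⁺ := posPart_nonneg
    have hn : ∀ z : E, 0 ≤ z⁻ := negPart_nonneg
    rw [hadd _ _ (hp _) (add_nonneg (hn _) (hn _)), hadd _ _ (hn _) (hn _),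
      hadd _ _ (add_nonneg (hp _) (hp _)) (hn _), hadd _ _ (hp _) (hp _)] at h'
    linarith
  · intro x
    have e1 : ‖x⁺‖ ≤ ‖x‖ := by
      rw [← norm_abs_eq_norm x, ← posPart_add_negPart]
      exact norm_le_norm_of_abs_le_abs (abs_le_abs_of_nonneg (posPart_nonneg x)
        (le_add_of_nonneg_right (negPart_nonneg x)))
    have e2 : ‖x⁻‖ ≤ ‖x‖ := by
      rw [← norm_abs_eq_norm x, ← posPart_add_negPart]
      exact norm_le_norm_of_abs_le_abs (abs_le_abs_of_nonneg (negPart_nonneg x)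
        (le_add_of_nonneg_left (posPart_nonneg x)))
    have a1 := h0 _ (posPart_nonneg x)
    have a2 := h0 _ (negPart_nonneg x)
    have b1 := (hC' _ (posPart_nonneg x)).trans (mul_le_mul_of_nonneg_left e1 (abs_nonneg C))
    have b2 := (hC' _ (negPart_nonneg x)).trans (mul_le_mul_of_nonneg_left e2 (abs_nonneg C))
    change |p x⁺ - p x⁻| ≤ |C| * ‖x‖
    rw [abs_le]
    constructor <;> linarith
  · change p x⁺ - p x⁻ = p x
    rw [posPart_of_nonneg hx, negPart_of_nonneg hx, hz, sub_zero]

/-- The component of a positive functional `f` on the ideal generated by an increasing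
sequence `w`. -/
theorem exists_component {f : StrongDual ℝ E} (hf : 0 ≤ f) {w : ℕ → E} (hw : Monotone w)
    (hw0 : ∀ n, 0 ≤ w n) (hw2 : ∀ n, w n + w n ≤ w (n + n)) :
    ∃ g : StrongDual ℝ E, ∀ x, 0 ≤ x → Tendsto (fun n => f (x ⊓ w n)) atTop (𝓝 (g x)) := by
  have hb : ∀ x, BddAbove (Set.range fun n => f (x ⊓ w n)) := fun x =>
    ⟨f x, by rintro _ ⟨n, rfl⟩; exact dual_mono hf inf_le_left⟩
  have ht : ∀ x, Tendsto (fun n => f (x ⊓ w n)) atTop (𝓝 (⨆ n, f (x ⊓ w n))) := fun x =>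
    tendsto_atTop_ciSup (fun n m h => dual_mono hf (inf_le_inf_left x (hw h))) (hb x)
  obtain ⟨g, hg⟩ := exists_dual_eq_of_additive (p := fun x => ⨆ n, f (x ⊓ w n)) (C := ‖f‖)
    (by
      intro x y hx hy
      apply le_antisymm
      · refine le_of_tendsto_of_tendsto' (ht (x + y)) ((ht x).add (ht y)) fun n => ?_
        rw [← map_add]
        exact dual_mono hf (add_inf_le_inf_add_inf hx (hw0 n) hy)
      · refine le_of_tendsto' ((ht x).add (ht y)) fun n => ?_
        rw [← map_add]
        refine le_trans (dual_mono hf (le_inf (add_le_add inf_le_left inf_le_left) ?_))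
          (le_ciSup (hb (x + y)) (n + n))
        exact (add_le_add inf_le_right inf_le_right).trans (hw2 n))
    (fun x hx => ge_of_tendsto' (ht x) fun n => hf _ (le_inf hx (hw0 n)))
    (fun x hx => le_of_tendsto' (ht x) fun n =>
      (dual_mono hf inf_le_left).trans ((le_abs_self _).trans (f.le_opNorm x)))
  exact ⟨g, fun x hx => by rw [hg x hx]; exact ht x⟩

theorem tendsto_apply_of_forall_nonneg {x : ℕ → E}
    (h : ∀ f : StrongDual ℝ E, 0 ≤ f → Tendsto (fun n => f (x n)) atTop (𝓝 0)) :
    WeaklyNull x := by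
  intro f
  have := (h f⁺ (posPart_nonneg f)).sub (h f⁻ (negPart_nonneg f))
  rw [sub_zero] at this
  refine this.congr fun n => ?_
  rw [← _root_.sub_apply, posPart_sub_negPart]

theorem exists_subseq_of_not_tendsto_zero {a : ℕ → ℝ} (ha : ∀ n, 0 ≤ a n)
    (h : ¬ Tendsto a atTop (𝓝 0)) :
    ∃ ε : ℝ, 0 < ε ∧ ∃ φ : ℕ → ℕ, StrictMono φ ∧ ∀ n, ε ≤ a (φ n) := by
  rw [Metric.tendsto_atTop] at h
  push Not at h
  obtain ⟨ε, hε, h⟩ := h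
  obtain ⟨φ, hφ, h⟩ := extraction_of_frequently_atTop (P := fun n => ε ≤ a n)
    (frequently_atTop.2 fun N => by
      obtain ⟨n, hn, h⟩ := h N
      refine ⟨n, hn, ?_⟩
      rwa [Real.dist_eq, sub_zero, abs_of_nonneg (ha n)] at h)
  exact ⟨ε, hε, φ, hφ, h⟩

/-- If the norm of `E*` is order continuous, then bounded disjoint positive sequences in `E` are
weakly null. -/
theorem OrderContinuousNorm.weaklyNull (hE : OrderContinuousNorm (StrongDual ℝ E)) {x : ℕ → E}
    (hx : ∀ n, 0 ≤ x n) (hd : DisjointSeq x) (hb : NormBoundedSeq x) : WeaklyNull x := by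
  refine tendsto_apply_of_forall_nonneg fun f hf => ?_
  by_contra hcon
  obtain ⟨ε, hε, φ, hφ, hfx⟩ := exists_subseq_of_not_tendsto_zero (fun n => hf _ (hx n)) hcon
  obtain ⟨C, hC⟩ := hb
  set y : ℕ → E := fun n => x (φ n) with hy
  have hy0 : ∀ n, 0 ≤ y n := fun n => hx _
  have hyd : ∀ n m, n ≠ m → y n ⊓ y m = 0 := fun n m h => hd.inf_eq_zero hx (hφ.injective.ne h)
  -- `t N` is `y` cut off after its first `N` terms. Below, `S` and `G N` are the components of `f`
  -- on the ideals generated by all of `y` and by `t N`. The functionals `S - G N` decrease to `0`,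
  -- yet each agrees with `f` at `y N`, because `y N` is disjoint from the earlier terms.
  let t : ℕ → ℕ → E := fun N n => if n < N then y n else 0
  have ht0 : ∀ N n, 0 ≤ t N n := fun N n => by dsimp only [t]; split_ifs <;> simp [hy0]
  have hty : ∀ N n, t N n ≤ y n := fun N n => by dsimp only [t]; split_ifs <;> simp [hy0]
  have htm : ∀ N M n, N ≤ M → t N n ≤ t M n := fun N M n h => by
    dsimp only [t]
    split_ifs
    · exact le_rfl
    · omega
    · exact hy0 n
    · exact le_rfl
  obtain ⟨S, hS⟩ := exists_component hf (seqHull_mono hy0) (seqHull_nonneg hy0)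
    (seqHull_add_self_le hy0)
  choose G hG using fun N => exists_component hf (seqHull_mono (ht0 N)) (seqHull_nonneg (ht0 N))
    (seqHull_add_self_le (ht0 N))
  have hGm : ∀ N M, N ≤ M → G N ≤ G M := fun N M h z hz =>
    le_of_tendsto_of_tendsto' (hG N z hz) (hG M z hz) fun n =>
      dual_mono hf (inf_le_inf_left z (seqHull_le_seqHull (fun i => htm N M i h) n))
  have hGS : ∀ N, G N ≤ S := fun N z hz =>
    le_of_tendsto_of_tendsto' (hG N z hz) (hS z hz) fun n =>
      dual_mono hf (inf_le_inf_left z (seqHull_le_seqHull (hty N) n))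
  have hle : ∀ N z, 0 ≤ z → f (z ⊓ seqHull y N) ≤ G N z := fun N z hz => by
    have h1 : seqHull y N = seqHull (t N) N := by
      unfold seqHull
      congr 1
      refine Finset.sum_congr rfl fun i hi => ?_
      simp [t, Finset.mem_range.1 hi]
    rw [h1]
    exact Monotone.ge_of_tendsto
      (fun n m h => dual_mono hf (inf_le_inf_left z (seqHull_mono (ht0 N) h))) (hG N z hz) N
  have hSy : ∀ N, S (y N) = f (y N) := fun N => by
    refine tendsto_nhds_unique (hS _ (hy0 N)) (tendsto_const_nhds.congr' ?_)
    filter_upwards [eventually_gt_atTop N] with n hn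
    rw [inf_eq_left.2 (le_seqHull hy0 hn)]
  have hGy : ∀ N, G N (y N) = 0 := fun N => by
    refine tendsto_nhds_unique (hG N _ (hy0 N)) (tendsto_const_nhds.congr fun n => ?_)
    rw [inf_seqHull_eq_zero (ht0 N) (hy0 N), map_zero]
    intro m
    dsimp only [t]
    split_ifs with h
    · exact hyd N m (by omega)
    · exact inf_eq_right.2 (hy0 N)
  obtain ⟨g, ⟨N, rfl⟩, hN⟩ := hE (Set.range fun N => S - G N) ⟨_, 0, rfl⟩
    (by
      rintro _ ⟨N, rfl⟩ _ ⟨M, rfl⟩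
      exact ⟨S - G (max N M), ⟨_, rfl⟩, sub_le_sub_left (hGm _ _ (le_max_left N M)) S,
        sub_le_sub_left (hGm _ _ (le_max_right N M)) S⟩)
    -- The infimum is computed pointwise on the cone: `(S - G N) z` is at most `S z - f (z ⊓ seqHull
    -- y N)`, which tends to `0` by the definition of `S`.
    ⟨by rintro _ ⟨N, rfl⟩; exact sub_nonneg.2 (hGS N), fun h hh z hz => by
      have h1 : Tendsto (fun N => S z - f (z ⊓ seqHull y N)) atTop (𝓝 (S z - S z)) :=
        (hS z hz).const_sub _
      rw [sub_self] at h1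
      refine ge_of_tendsto' h1 fun N => ?_
      have h2 := hh ⟨N, rfl⟩ z hz
      rw [_root_.sub_apply] at h2
      linarith [hle N z hz]⟩
    (ε / (|C| + 1)) (by positivity)
  have h1 := (le_abs_self _).trans ((S - G N).le_opNorm (y N))
  rw [_root_.sub_apply, hSy, hGy, sub_zero] at h1
  have h2 : ‖y N‖ ≤ |C| := (hC _).trans (le_abs_self C)
  have h3 := hfx N
  rw [lt_div_iff₀ (by positivity)] at hN
  have h4 : ‖S - G N‖ * ‖y N‖ ≤ ‖S - G N‖ * |C| := by gcongr
  have h5 : (0 : ℝ) ≤ ‖S - G N‖ := norm_nonneg _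
  change ε ≤ f (y N) at h3
  linarith

/-- Let `g` be the component of `f` on the ideal generated by all the positive parts. Every negative
part is disjoint from that ideal, so `g (x n) = f (x n)⁺`, and weak nullity of `x` is tested against
the single functional `g`. -/
theorem tendsto_posPart_of_disjoint_of_weaklyNull {x : ℕ → E} (hd : DisjointSeq x)
    (hw : WeaklyNull x) {f : StrongDual ℝ E} (hf : 0 ≤ f) :
    Tendsto (fun n => f (x n)⁺) atTop (𝓝 0) := by
  have hp : ∀ n, 0 ≤ (x n)⁺ := fun n => posPart_nonneg _
  obtain ⟨g, hg⟩ := exists_component hf (seqHull_mono hp) (seqHull_nonneg hp)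
    (seqHull_add_self_le hp)
  refine (hw g).congr fun n => ?_
  have h1 : g (x n)⁺ = f (x n)⁺ := by
    refine tendsto_nhds_unique (hg _ (hp n)) (tendsto_const_nhds.congr' ?_)
    filter_upwards [eventually_gt_atTop n] with m hm
    rw [inf_eq_left.2 (le_seqHull hp hm)]
  have h2 : g (x n)⁻ = 0 := by
    refine tendsto_nhds_unique (hg _ (negPart_nonneg _)) (tendsto_const_nhds.congr fun m => ?_)
    rw [inf_seqHull_eq_zero hp (negPart_nonneg _), map_zero]
    intro k
    rcases eq_or_ne n k with rfl | hnk
    · rw [inf_comm, posPart_inf_negPart_eq_zero]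
    · refine inf_eq_zero_of_le (negPart_nonneg _) (hp k) ?_ ?_ (hd n k hnk)
      · rw [← posPart_add_negPart]; exact le_add_of_nonneg_left (hp n)
      · rw [← posPart_add_negPart]; exact le_add_of_nonneg_right (negPart_nonneg _)
  conv_lhs => rw [← posPart_sub_negPart (x n)]
  rw [map_sub, h1, h2, sub_zero]

/-- The moduli of a disjoint weakly null sequence form a weakly null sequence. -/
theorem WeaklyNull.abs_of_disjoint {x : ℕ → E} (hw : WeaklyNull x) (hd : DisjointSeq x) :
    WeaklyNull fun n => |x n| := by
  refine tendsto_apply_of_forall_nonneg fun f hf => ?_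
  have h1 := tendsto_posPart_of_disjoint_of_weaklyNull hd hw hf
  have h2 := tendsto_posPart_of_disjoint_of_weaklyNull (x := fun n => - x n)
    (fun n m h => by simpa only [abs_neg] using hd n m h)
    (fun g => by simpa only [map_neg, neg_zero] using (hw g).neg) hf
  have h3 := h1.add h2
  rw [add_zero] at h3
  refine h3.congr fun n => ?_
  rw [posPart_neg, ← map_add, posPart_add_negPart]

end Functionals

/-! ### Disjointification -/

section Disjointification

variable {E : Type*} [NormedAddCommGroup E] [NormedSpace ℝ E] [Lattice E]
  [IsOrderedAddMonoid E] [IsOrderedModule ℝ E]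

/-- Since `1 ≤ s * t`, `b - t • a` is at most `t • (s • b - a)`, hence at most a multiple of the
negative part of `a - s • b`, which is disjoint from its positive part. Rounding `t` up to an
integer reduces this to disjointness from natural multiples. -/
theorem posPart_sub_smul_inf_eq_zero {a b : E} {s t : ℝ} (ht : 0 ≤ t) (hst : 1 ≤ s * t)
    (hb : 0 ≤ b) : (a - s • b)⁺ ⊓ (b - t • a)⁺ = 0 := by
  obtain ⟨n, hn⟩ := exists_nat_ge t
  have hneg := negPart_nonneg (a - s • b)
  refine inf_eq_zero_of_le (posPart_nonneg _) (posPart_nonneg _) le_rfl ?_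
    (inf_nsmul_eq_zero n (posPart_nonneg _) hneg (posPart_inf_negPart_eq_zero (a - s • b)))
  refine sup_le ?_ (nsmul_nonneg hneg n)
  have h1 : b ≤ (s * t) • b := by
    simpa using smul_le_smul_of_nonneg_right hst hb
  calc b - t • a ≤ (s * t) • b - t • a := sub_le_sub_right h1 _
    _ = t • -(a - s • b) := by rw [mul_comm, mul_smul, ← smul_sub, neg_sub]
    _ ≤ t • (a - s • b)⁻ := smul_le_smul_of_nonneg_left (neg_le_negPart _) ht
    _ ≤ (n : ℝ) • (a - s • b)⁻ := smul_le_smul_of_nonneg_right hn hneg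
    _ = n • (a - s • b)⁻ := Nat.cast_smul_eq_nsmul ℝ n _

variable [HasSolidNorm E] [CompleteSpace E]

/-- A bounded positive sequence dominates a disjoint one, with an explicit control of the
difference. -/
theorem exists_disjointSeq_le {x : ℕ → E} {C : ℝ} (hx : ∀ n, 0 ≤ x n) (hC : ∀ n, ‖x n‖ ≤ C) :
    ∃ (z : ℕ → E) (s : E), DisjointSeq z ∧ (∀ n, 0 ≤ z n) ∧ (∀ n, z n ≤ x n) ∧
      ∀ n, x n ≤ z n + ((4 : ℝ) ^ n • ∑ i ∈ Finset.range n, x i + (1 / 2 : ℝ) ^ n • s) := by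
  have hs : Summable fun n => (1 / 2 : ℝ) ^ n • x n := by
    refine Summable.of_norm_bounded (summable_geometric_two.mul_right C) fun n => ?_
    rw [norm_smul, Real.norm_of_nonneg (by positivity)]
    exact mul_le_mul_of_nonneg_left (hC n) (by positivity)
  have hterm : ∀ n, 0 ≤ (1 / 2 : ℝ) ^ n • x n := fun n => smul_nonneg (by positivity) (hx n)
  set s := ∑' n, (1 / 2 : ℝ) ^ n • x n with hs_def
  have hs_le : ∀ n, (1 / 2 : ℝ) ^ n • x n ≤ s := fun n => hs.le_tsum n fun j _ => hterm j
  have hs0 : 0 ≤ s := (hterm 0).trans (hs_le 0)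
  -- The disjoint sequence will be `(x n - r n)⁺`. For `m < n`, the sum in `r n` dominates `4 ^ n •
  -- x m`, while the multiple of `s` in `r m` dominates `(1 / 2) ^ (m + n) • x n`. The product of
  -- these coefficients is at least `1`, as `posPart_sub_smul_inf_eq_zero` requires.
  set r : ℕ → E := fun n => (4 : ℝ) ^ n • ∑ i ∈ Finset.range n, x i + (1 / 2 : ℝ) ^ n • s
    with hr
  have hsum : ∀ n, 0 ≤ (4 : ℝ) ^ n • ∑ i ∈ Finset.range n, x i := fun n =>
    smul_nonneg (by positivity) (Finset.sum_nonneg fun i _ => hx i)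
  have hs1 : ∀ n, 0 ≤ (1 / 2 : ℝ) ^ n • s := fun n => smul_nonneg (by positivity) hs0
  have hdisj : ∀ m n, m < n → (x n - r n)⁺ ⊓ (x m - r m)⁺ = 0 := by
    intro m n hmn
    have h1 : (4 : ℝ) ^ n • x m ≤ r n :=
      (smul_le_smul_of_nonneg_left
        (Finset.single_le_sum (fun i _ => hx i) (Finset.mem_range.2 hmn)) (by positivity)).trans
        (le_add_of_nonneg_right (hs1 n))
    have h2 : (1 / 2 : ℝ) ^ (m + n) • x n ≤ r m := by
      rw [pow_add, mul_smul]
      exact (smul_le_smul_of_nonneg_left (hs_le n) (by positivity)).trans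
        (le_add_of_nonneg_left (hsum m))
    refine inf_eq_zero_of_le (posPart_nonneg _) (posPart_nonneg _)
      (posPart_mono (sub_le_sub_left h1 _)) (posPart_mono (sub_le_sub_left h2 _))
      (posPart_sub_smul_inf_eq_zero (by positivity) ?_ (hx m))
    calc (1 : ℝ) = 4 ^ n * (1 / 2) ^ (n + n) := by
          rw [pow_add, ← mul_pow, ← mul_pow]; norm_num
      _ ≤ 4 ^ n * (1 / 2) ^ (m + n) := by
          refine mul_le_mul_of_nonneg_left ?_ (by positivity)
          exact pow_le_pow_of_le_one (by norm_num) (by norm_num) (by omega)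
  refine ⟨fun n => (x n - r n)⁺, s, ?_, fun n => posPart_nonneg _, fun n => ?_, fun n => ?_⟩
  · intro n m hnm
    dsimp only
    rw [abs_of_nonneg (posPart_nonneg _), abs_of_nonneg (posPart_nonneg _)]
    rcases lt_or_gt_of_ne hnm with h | h
    · rw [inf_comm]; exact hdisj n m h
    · exact hdisj m n h
  · exact sup_le (sub_le_self _ (add_nonneg (hsum n) (hs1 n))) (hx n)
  · exact sub_le_iff_le_add.1 (le_posPart (x n - r n))

/-- After passing to a subsequence along which `u n` is tiny on all earlier `x i`, the correction in
`exists_disjointSeq_le` costs at most `ε / 2`: one quarter of `ε` for the weighted sum of earlier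
terms, one for the tail `(1 / 2) ^ n • s`. -/
theorem exists_disjointSeq_of_tendsto {x : ℕ → E} {u : ℕ → StrongDual ℝ E} {C K ε : ℝ}
    (hx : ∀ n, 0 ≤ x n) (hC : ∀ n, ‖x n‖ ≤ C) (hu : ∀ n, 0 ≤ u n) (hK : ∀ n, ‖u n‖ ≤ K)
    (hε : 0 < ε) (hux : ∀ n, ε ≤ u n (x n))
    (ht : ∀ i, Tendsto (fun n => u n (x i)) atTop (𝓝 0)) :
    ∃ φ : ℕ → ℕ, StrictMono φ ∧ ∃ z : ℕ → E, DisjointSeq z ∧ (∀ k, 0 ≤ z k) ∧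
      (∀ k, z k ≤ x (φ k)) ∧ ∀ k, ε / 2 ≤ u (φ k) (z k) := by
  -- The first coordinate is a strictly increasing counter, hence at least `j` at stage `j`, and it
  -- sets the decay rate. The rate `(1 / 8) ^ j` beats both the weight `4 ^ j` and the number `j` of
  -- summands.
  obtain ⟨p, -, hp⟩ := exists_seq_of_forall_finset_exists (α := ℕ × ℕ) (fun _ => True)
    (fun p q => p.1 < q.1 ∧ p.2 < q.2 ∧ u q.2 (x p.2) ≤ ε / 4 * (1 / 8) ^ q.1) (by
      intro s _
      obtain ⟨k, hk⟩ := (s.image Prod.fst).bddAbove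
      have h1 : ∀ᶠ n in atTop, ∀ p ∈ s, p.2 < n ∧ u n (x p.2) ≤ ε / 4 * (1 / 8) ^ (k + 1) := by
        rw [Filter.eventually_all_finset]
        intro p _
        exact (eventually_gt_atTop p.2).and ((ht p.2).eventually_le_const (by positivity))
      obtain ⟨n, hn⟩ := h1.exists
      exact ⟨(k + 1, n), trivial, fun p hps =>
        ⟨Nat.lt_succ_of_le (hk (Finset.mem_coe.2 (Finset.mem_image_of_mem _ hps))), hn p hps⟩⟩)
  have hk : StrictMono fun j => (p j).1 := fun i j h => (hp i j h).1
  have hn : StrictMono fun j => (p j).2 := fun i j h => (hp i j h).2.1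
  set n : ℕ → ℕ := fun j => (p j).2 with hn_def
  have hsmall : ∀ i j, i < j → u (n j) (x (n i)) ≤ ε / 4 * (1 / 8) ^ j := fun i j h =>
    (hp i j h).2.2.trans (mul_le_mul_of_nonneg_left
      (pow_le_pow_of_le_one (by norm_num) (by norm_num) (hk.id_le j)) (by positivity))
  obtain ⟨z, s, hzd, hz0, hzx, hz⟩ := exists_disjointSeq_le (fun j => hx (n j)) fun j => hC (n j)
  have htail : ∀ᶠ j in atTop, (1 / 2 : ℝ) ^ j * (K * ‖s‖) ≤ ε / 4 := by
    have : Tendsto (fun j => (1 / 2 : ℝ) ^ j * (K * ‖s‖)) atTop (𝓝 (0 * (K * ‖s‖))) :=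
      (tendsto_pow_atTop_nhds_zero_of_lt_one (by norm_num) (by norm_num)).mul_const _
    rw [zero_mul] at this
    exact this.eventually_le_const (by positivity)
  -- The tail term is small only from some `J` on, so the first `J` terms are dropped.
  obtain ⟨J, hJ⟩ := eventually_atTop.1 htail
  have hshift : StrictMono fun k : ℕ => k + J := fun a b h => Nat.add_lt_add_right h J
  refine ⟨fun k => n (k + J), hn.comp hshift, fun k => z (k + J), hzd.comp hshift.injective,
    fun k => hz0 _, fun k => hzx _, fun k => ?_⟩
  set j := k + J
  have h1 := dual_mono (hu (n j)) (hz j)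
  simp only [map_add, map_smul, map_sum, smul_eq_mul] at h1
  have h2 : (4 : ℝ) ^ j * ∑ i ∈ Finset.range j, u (n j) (x (n i)) ≤ ε / 4 := by
    calc (4 : ℝ) ^ j * ∑ i ∈ Finset.range j, u (n j) (x (n i))
        ≤ 4 ^ j * ∑ i ∈ Finset.range j, ε / 4 * (1 / 8) ^ j := by
          gcongr with i hi
          exact hsmall i j (Finset.mem_range.1 hi)
      _ = ε / 4 * (j * (4 ^ j * (1 / 8) ^ j)) := by
          rw [Finset.sum_const, Finset.card_range, nsmul_eq_mul]; ring
      _ = ε / 4 * (j / 2 ^ j) := by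
          rw [← mul_pow, div_eq_mul_inv (j : ℝ), ← inv_pow]; norm_num
      _ ≤ ε / 4 := by
          refine mul_le_of_le_one_right (by positivity) ?_
          rw [div_le_one (by positivity)]
          exact_mod_cast Nat.lt_two_pow_self.le
  have h3 : (1 / 2 : ℝ) ^ j * u (n j) s ≤ ε / 4 := by
    refine (mul_le_mul_of_nonneg_left ?_ (by positivity)).trans (hJ j (Nat.le_add_left J k))
    refine (le_abs_self _).trans (((u (n j)).le_opNorm s).trans ?_)
    exact mul_le_mul_of_nonneg_right (hK _) (norm_nonneg _)
  have h4 := hux (n j)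
  linarith

end Disjointification

/-! ### Norming vectors and Goldstine approximation in the positive cone -/

section Goldstine

variable {E : Type*} [NormedAddCommGroup E] [NormedSpace ℝ E] [Lattice E]
  [IsOrderedAddMonoid E] [HasSolidNorm E]

theorem norm_le_of_forall_apply_nonneg_le {f : StrongDual ℝ E} (hf : 0 ≤ f) {M : ℝ} (hM : 0 ≤ M)
    (h : ∀ x, 0 ≤ x → f x ≤ M * ‖x‖) : ‖f‖ ≤ M := by
  refine f.opNorm_le_bound hM fun x => ?_
  have h1 := abs_apply_le_dual_abs f x
  rw [abs_of_nonneg hf] at h1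
  have h2 := h _ (abs_nonneg x)
  rw [norm_abs_eq_norm] at h2
  exact h1.trans h2

/-- Positive functionals almost attain their norm on the positive part of the unit ball. -/
theorem exists_nonneg_half_norm_le [IsOrderedModule ℝ E] {f : StrongDual ℝ E} (hf : 0 ≤ f) :
    ∃ x : E, 0 ≤ x ∧ ‖x‖ ≤ 1 ∧ ‖f‖ / 2 ≤ f x := by
  by_contra! hcon
  rcases eq_or_ne ‖f‖ 0 with h0 | h0
  · have := hcon 0 le_rfl (by simp)
    simp [h0] at this
  have hpos : 0 < ‖f‖ := lt_of_le_of_ne (norm_nonneg f) h0.symm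
  have : ‖f‖ ≤ ‖f‖ / 2 := by
    refine norm_le_of_forall_apply_nonneg_le hf (by positivity) fun x hx => ?_
    rcases eq_or_ne x 0 with rfl | hx0
    · simp
    have nx := norm_pos_iff.2 hx0
    have := hcon (‖x‖⁻¹ • x) (smul_nonneg (by positivity) hx) (by rw [norm_smul]; simp [nx.ne'])
    rw [map_smul, smul_eq_mul, inv_mul_lt_iff₀ nx] at this
    linarith
  linarith

/-- Goldstine's theorem for the positive cone. -/
theorem exists_nonneg_approx_bidual [IsOrderedModule ℝ E] {u : StrongDual ℝ (StrongDual ℝ E)}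
    (hu : 0 ≤ u) {C : ℝ} (hC : ‖u‖ ≤ C) (s : Finset (StrongDual ℝ E)) {δ : ℝ} (hδ : 0 < δ) :
    ∃ x : E, 0 ≤ x ∧ ‖x‖ ≤ C + 1 ∧ ∀ f ∈ s, |f x - u f| < δ := by
  classical
  have hC0 : 0 ≤ C := (norm_nonneg u).trans hC
  let Φ : E →ₗ[ℝ] (s → ℝ) := LinearMap.pi fun f => (f : StrongDual ℝ E).toLinearMap
  -- The radius `C + 1` instead of `C` keeps the later division legitimate when `C = 0`.
  let B : Set E := {x | 0 ≤ x ∧ ‖x‖ ≤ C + 1}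
  have hB : Convex ℝ B := by
    intro x hx y hy a b ha hb hab
    refine ⟨add_nonneg (smul_nonneg ha hx.1) (smul_nonneg hb hy.1), ?_⟩
    refine (norm_add_le _ _).trans ?_
    rw [norm_smul, norm_smul, Real.norm_of_nonneg ha, Real.norm_of_nonneg hb]
    calc a * ‖x‖ + b * ‖y‖ ≤ a * (C + 1) + b * (C + 1) := by gcongr; exacts [hx.2, hy.2]
      _ = C + 1 := by rw [← add_mul, hab, one_mul]
  by_cases hmem : (fun f : s => u f) ∈ closure (Φ '' B)
  · obtain ⟨_, ⟨x, hx, rfl⟩, hd⟩ := Metric.mem_closure_iff.1 hmem δ hδ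
    refine ⟨x, hx.1, hx.2, fun f hf => ?_⟩
    have := (dist_pi_lt_iff hδ).1 hd ⟨f, hf⟩
    rwa [dist_comm, Real.dist_eq] at this
  · exfalso
    obtain ⟨l, c, hlc, hcl⟩ := geometric_hahn_banach_closed_point (hB.linear_image Φ).closure
      isClosed_closure hmem
    -- The separating functional on the finite product pulls back to a functional `g` on `E` with `g
    -- ≤ c` on `B` and `c < u g`.
    set g : StrongDual ℝ E := ∑ f : s, l (Pi.single f 1) • (f : StrongDual ℝ E) with hg
    have hl : ∀ v : s → ℝ, l v = ∑ f : s, l (Pi.single f 1) * v f := fun v => by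
      have := l.toLinearMap.pi_apply_eq_sum_univ v
      refine this.trans (Finset.sum_congr rfl fun f _ => ?_)
      rw [smul_eq_mul, mul_comm]
      refine congrArg (fun w => l w * v f) ?_
      ext f'
      simp [Pi.single_apply, eq_comm]
    have hgx : ∀ x ∈ B, g x ≤ c := fun x hx => by
      have := hlc _ (subset_closure ⟨x, hx, rfl⟩)
      rw [hl] at this
      simp only [hg, _root_.sum_apply, _root_.smul_apply, smul_eq_mul]
      exact this.le
    have hgu : c < u g := by
      rw [hl] at hcl
      simpa only [hg, map_sum, map_smul, smul_eq_mul] using hcl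
    have hc0 : 0 ≤ c := by
      simpa using hgx 0 ⟨le_rfl, by simpa using add_nonneg hC0 zero_le_one⟩
    -- `B` contains every positive element below one of its members, so the Riesz-Kantorovich
    -- formula carries the bound `c` from `g` to its positive part. This bounds the norm of the
    -- positive part, and `u g ≤ u g⁺` then contradicts the separation.
    have hsup : ∀ x ∈ B, dualPos g x ≤ c := fun x hx => by
      rw [dualPos_apply g hx.1]
      exact dualPosAux_le g hx.1 fun y h0 hy =>
        hgx y ⟨h0, (norm_le_norm_of_abs_le_abs (abs_le_abs_of_nonneg h0 hy)).trans hx.2⟩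
    have hpos : 0 ≤ dualPos g := fun x hx => by
      rw [dualPos_apply g hx]; exact dualPosAux_nonneg g hx
    have hle : g ≤ dualPos g := fun x hx => by
      rw [dualPos_apply g hx]; exact le_dualPosAux g hx le_rfl
    have hn : ‖dualPos g‖ ≤ c / (C + 1) := by
      refine norm_le_of_forall_apply_nonneg_le hpos (by positivity) fun x hx => ?_
      rcases eq_or_ne x 0 with rfl | hx0
      · simp
      have nx := norm_pos_iff.2 hx0
      have := hsup (((C + 1) / ‖x‖) • x) ⟨smul_nonneg (by positivity) hx, by
        rw [norm_smul, Real.norm_of_nonneg (by positivity), div_mul_cancel₀ _ nx.ne']⟩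
      rw [map_smul, smul_eq_mul, div_mul_eq_mul_div, div_le_iff₀ nx] at this
      rw [div_mul_eq_mul_div, le_div_iff₀ (by positivity)]
      linarith
    have h1 : u g ≤ C * (c / (C + 1)) :=
      (dual_mono hu hle).trans ((le_abs_self _).trans ((u.le_opNorm _).trans
        (mul_le_mul hC hn (norm_nonneg _) hC0)))
    have h2 : C * (c / (C + 1)) ≤ c := by
      rw [← mul_div_assoc, div_le_iff₀ (by positivity)]
      nlinarith
    linarith

end Goldstine

/-! ### Positive bilinear forms -/

section Forms

variable {E₁ E₂ : Type*}
  [NormedAddCommGroup E₁] [NormedSpace ℝ E₁] [CompleteSpace E₁] [Lattice E₁]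
  [IsOrderedAddMonoid E₁] [IsOrderedModule ℝ E₁] [HasSolidNorm E₁]
  [NormedAddCommGroup E₂] [NormedSpace ℝ E₂] [CompleteSpace E₂] [Lattice E₂]
  [IsOrderedAddMonoid E₂] [IsOrderedModule ℝ E₂] [HasSolidNorm E₂]

/-- The negated condition is what Goldstine approximation extracts from a failure of convergence in
the biduals. It permits an inductive choice with `a (x n) (y i) → 0` for fixed `i`; disjointifying
first in `E₂` and then in `E₁` contradicts `had`. -/
theorem not_forall_finset_exists_le_form (hE₁ : OrderContinuousNorm (StrongDual ℝ E₁))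
    (hE₂ : OrderContinuousNorm (StrongDual ℝ E₂)) {a : E₁ →L[ℝ] StrongDual ℝ E₂}
    (ha : ∀ x, 0 ≤ x → 0 ≤ a x)
    (had : ∀ (x : ℕ → E₁) (y : ℕ → E₂), DisjointSeq x → WeaklyNull x → DisjointSeq y →
      WeaklyNull y → Tendsto (fun n => a (x n) (y n)) atTop (𝓝 0))
    {ε C : ℝ} (hε : 0 < ε) :
    ¬ ∀ S : Finset E₂, (∀ y ∈ S, 0 ≤ y) → ∀ δ : ℝ, 0 < δ → ∃ x y, 0 ≤ x ∧ 0 ≤ y ∧ ‖x‖ ≤ C ∧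
      ‖y‖ ≤ C ∧ ε ≤ a x y ∧ ∀ y' ∈ S, a x y' ≤ δ := by
  classical
  intro H
  obtain ⟨p, hp, hpr⟩ := exists_seq_of_forall_finset_exists (α := ℕ × E₁ × E₂)
    (fun p => 0 ≤ p.2.1 ∧ 0 ≤ p.2.2 ∧ ‖p.2.1‖ ≤ C ∧ ‖p.2.2‖ ≤ C ∧ ε ≤ a p.2.1 p.2.2)
    (fun p q => p.1 < q.1 ∧ a q.2.1 p.2.2 ≤ 1 / ((q.1 : ℝ) + 1)) (by
      intro s hs
      obtain ⟨k, hk⟩ := (s.image Prod.fst).bddAbove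
      obtain ⟨x, y, hx, hy, hxC, hyC, hxy, hS⟩ := H (s.image fun p => p.2.2)
        (by
          intro y hy
          obtain ⟨p, hp, rfl⟩ := Finset.mem_image.1 hy
          exact (hs p hp).2.1)
        (1 / (((k + 1 : ℕ) : ℝ) + 1)) (by positivity)
      exact ⟨(k + 1, x, y), ⟨hx, hy, hxC, hyC, hxy⟩, fun p hps =>
        ⟨Nat.lt_succ_of_le (hk (Finset.mem_coe.2 (Finset.mem_image_of_mem _ hps))),
          hS _ (Finset.mem_image_of_mem _ hps)⟩⟩)
  have hk : StrictMono fun n => (p n).1 := fun i j h => (hpr i j h).1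
  set x : ℕ → E₁ := fun n => (p n).2.1 with hx_def
  set y : ℕ → E₂ := fun n => (p n).2.2 with hy_def
  have hx0 : ∀ n, 0 ≤ x n := fun n => (hp n).1
  have hy0 : ∀ n, 0 ≤ y n := fun n => (hp n).2.1
  have hxC : ∀ n, ‖x n‖ ≤ C := fun n => (hp n).2.2.1
  have hyC : ∀ n, ‖y n‖ ≤ C := fun n => (hp n).2.2.2.1
  have hxy : ∀ n, ε ≤ a (x n) (y n) := fun n => (hp n).2.2.2.2
  have hlim : ∀ i, Tendsto (fun n => a (x n) (y i)) atTop (𝓝 0) := fun i => by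
    refine squeeze_zero' (Eventually.of_forall fun n => ha _ (hx0 n) _ (hy0 i)) ?_
      tendsto_one_div_add_atTop_nhds_zero_nat
    filter_upwards [eventually_gt_atTop i] with n hn
    refine (hpr i n hn).2.trans (one_div_le_one_div_of_le (by positivity) ?_)
    have : n ≤ (p n).1 := hk.id_le n
    gcongr
  obtain ⟨φ, hφ, w, hwd, hw0, hwy, hw⟩ := exists_disjointSeq_of_tendsto hy0 hyC
    (fun n => ha _ (hx0 n)) (K := ‖a‖ * C)
    (fun n => (a.le_opNorm _).trans (mul_le_mul_of_nonneg_left (hxC n) (norm_nonneg _)))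
    hε hxy hlim
  have hwC : ∀ n, ‖w n‖ ≤ C := fun n => (norm_le_norm_of_abs_le_abs
    (abs_le_abs_of_nonneg (hw0 n) (hwy n))).trans (hyC _)
  have hwn : WeaklyNull w := hE₂.weaklyNull hw0 hwd ⟨C, hwC⟩
  -- The second disjointification runs in `E₁` with the functionals `a.flip (w n)`; they vanish in
  -- the limit at each fixed vector because `w` is weakly null.
  obtain ⟨ψ, hψ, z, hzd, hz0, hzx, hz⟩ := exists_disjointSeq_of_tendsto (x := fun n => x (φ n))
    (u := fun n => a.flip (w n)) (fun n => hx0 _) (fun n => hxC _)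
    (fun n z hz => ha z hz _ (hw0 n)) (K := ‖a.flip‖ * C)
    (fun n => (a.flip.le_opNorm _).trans (mul_le_mul_of_nonneg_left (hwC n) (norm_nonneg _)))
    (half_pos hε) hw (fun i => hwn (a (x (φ i))))
  have hzC : ∀ n, ‖z n‖ ≤ C := fun n => (norm_le_norm_of_abs_le_abs
    (abs_le_abs_of_nonneg (hz0 n) (hzx n))).trans (hxC _)
  have hzn : WeaklyNull z := hE₁.weaklyNull hz0 hzd ⟨C, hzC⟩
  have hfin := had z (w ∘ ψ) hzd hzn (hwd.comp hψ.injective)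
    (fun f => (hwn f).comp hψ.tendsto_atTop)
  have : ε / 2 / 2 ≤ 0 := ge_of_tendsto' hfin hz
  linarith

theorem weakStarNull_bounded {E : Type*} [NormedAddCommGroup E] [NormedSpace ℝ E]
    [CompleteSpace E] {f : ℕ → StrongDual ℝ E} (hf : WeakStarNull f) : NormBoundedSeq f :=
  banach_steinhaus fun x => by
    obtain ⟨C, hC⟩ := (hf x).norm.bddAbove_range
    exact ⟨C, fun n => hC ⟨n, rfl⟩⟩

/-- Both extensions of a positive almost Dunford-Pettis form send pairs consisting of a positive
weak* null sequence and a positive bounded sequence to null sequences. -/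
theorem tendsto_extensions_of_form (hE₁ : OrderContinuousNorm (StrongDual ℝ E₁))
    (hE₂ : OrderContinuousNorm (StrongDual ℝ E₂)) {a : E₁ →L[ℝ] StrongDual ℝ E₂}
    (ha : ∀ x, 0 ≤ x → 0 ≤ a x)
    (had : ∀ (x : ℕ → E₁) (y : ℕ → E₂), DisjointSeq x → WeaklyNull x → DisjointSeq y →
      WeaklyNull y → Tendsto (fun n => a (x n) (y n)) atTop (𝓝 0))
    {u : ℕ → StrongDual ℝ (StrongDual ℝ E₁)} {v : ℕ → StrongDual ℝ (StrongDual ℝ E₂)}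
    (hu0 : ∀ n, 0 ≤ u n) (hv0 : ∀ n, 0 ≤ v n) (hu : WeakStarNull u) (hv : NormBoundedSeq v) :
    Tendsto (fun n => u n ((v n).comp a)) atTop (𝓝 0) ∧
      Tendsto (fun n => v n ((u n).comp a.flip)) atTop (𝓝 0) := by
  classical
  obtain ⟨C₁, hC₁⟩ := weakStarNull_bounded hu
  obtain ⟨C₂, hC₂⟩ := hv
  set C := max C₁ C₂ with hC
  have hu1 : ∀ n, ‖u n‖ ≤ C := fun n => (hC₁ n).trans (le_max_left _ _)
  have hv1 : ∀ n, ‖v n‖ ≤ C := fun n => (hC₂ n).trans (le_max_right _ _)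
  have ha' : ∀ y, 0 ≤ y → 0 ≤ a.flip y := fun y hy x hx => ha x hx y hy
  have hva : ∀ n, 0 ≤ (v n).comp a := fun n x hx => hv0 n _ (ha x hx)
  have hua : ∀ n, 0 ≤ (u n).comp a.flip := fun n y hy => hu0 n _ (ha' y hy)
  have hsmall : ∀ (φ : ℕ → ℕ), StrictMono φ → ∀ (S : Finset E₂) (δ : ℝ), 0 < δ →
      ∃ n, ∀ y ∈ S, u (φ n) (a.flip y) ≤ δ := fun φ hφ S δ hδ => by
    refine (Filter.Eventually.exists (f := atTop) ?_)
    rw [Filter.eventually_all_finset]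
    exact fun y _ => ((hu (a.flip y)).comp hφ.tendsto_atTop).eventually_le_const hδ
  constructor
  · by_contra hcon
    obtain ⟨ε, hε, φ, hφ, h⟩ := exists_subseq_of_not_tendsto_zero
      (fun n => hu0 n _ (hva n)) hcon
    refine not_forall_finset_exists_le_form hE₁ hE₂ ha had (ε := ε / 4) (C := C + 1)
      (by positivity) fun S hS δ hδ => ?_
    obtain ⟨n, hn⟩ := hsmall φ hφ S (δ / 2) (half_pos hδ)
    -- The outer functional is approximated first: `x` replaces `u (φ n)` at `(v (φ n)).comp a` at a
    -- cost of `ε / 2`, then `y` replaces `v (φ n)` at `a x` at a cost of `ε / 4`. The same `x`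
    -- inherits smallness on `S`.
    obtain ⟨x, hx, hxC, hxS⟩ := exists_nonneg_approx_bidual (hu0 (φ n)) (hu1 (φ n))
      (insert ((v (φ n)).comp a) (S.image a.flip)) (lt_min (half_pos hδ) (half_pos hε))
    obtain ⟨y, hy, hyC, hyS⟩ := exists_nonneg_approx_bidual (hv0 (φ n)) (hv1 (φ n))
      {a x} (δ := ε / 4) (by positivity)
    refine ⟨x, y, hx, hy, hxC, hyC, ?_, fun y' hy' => ?_⟩
    · have h1 := (abs_lt.1 (hxS _ (Finset.mem_insert_self _ _))).1
      have h2 := (abs_lt.1 (hyS _ (Finset.mem_singleton_self _))).1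
      have h3 := min_le_right (δ / 2) (ε / 2)
      have h4 := h n
      rw [ContinuousLinearMap.comp_apply] at h1
      linarith
    · have h1 := (abs_lt.1 (hxS (a.flip y')
        (Finset.mem_insert_of_mem (Finset.mem_image_of_mem _ hy')))).2
      have h2 := min_le_left (δ / 2) (ε / 2)
      have h3 := hn y' hy'
      rw [ContinuousLinearMap.flip_apply] at h1
      linarith
  · by_contra hcon
    obtain ⟨ε, hε, φ, hφ, h⟩ := exists_subseq_of_not_tendsto_zero
      (fun n => hv0 n _ (hua n)) hcon
    refine not_forall_finset_exists_le_form hE₁ hE₂ ha had (ε := ε / 4) (C := C + 1)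
      (by positivity) fun S hS δ hδ => ?_
    obtain ⟨n, hn⟩ := hsmall φ hφ S (δ / 2) (half_pos hδ)
    -- Here `v (φ n)` is the outer functional, so `y` is chosen first, and `x` must then handle
    -- `a.flip y` and `S` simultaneously.
    obtain ⟨y, hy, hyC, hyS⟩ := exists_nonneg_approx_bidual (hv0 (φ n)) (hv1 (φ n))
      {(u (φ n)).comp a.flip} (half_pos hε)
    obtain ⟨x, hx, hxC, hxS⟩ := exists_nonneg_approx_bidual (hu0 (φ n)) (hu1 (φ n))
      (insert (a.flip y) (S.image a.flip)) (δ := min (δ / 2) (ε / 4))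
      (lt_min (half_pos hδ) (by positivity))
    refine ⟨x, y, hx, hy, hxC, hyC, ?_, fun y' hy' => ?_⟩
    · have h1 := (abs_lt.1 (hxS _ (Finset.mem_insert_self _ _))).1
      have h2 := (abs_lt.1 (hyS _ (Finset.mem_singleton_self _))).1
      have h3 := min_le_right (δ / 2) (ε / 4)
      have h4 := h n
      rw [ContinuousLinearMap.comp_apply] at h2
      rw [ContinuousLinearMap.flip_apply] at h1
      linarith
    · have h1 := (abs_lt.1 (hxS (a.flip y')
        (Finset.mem_insert_of_mem (Finset.mem_image_of_mem _ hy')))).2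
      have h2 := min_le_left (δ / 2) (ε / 4)
      have h3 := hn y' hy'
      rw [ContinuousLinearMap.flip_apply] at h1
      linarith

end Forms

/-! ### A sufficient condition for the dual positive Schur property -/

section DualPositiveSchur

variable {F : Type*} [NormedAddCommGroup F] [NormedSpace ℝ F] [CompleteSpace F] [Lattice F]
  [IsOrderedAddMonoid F] [IsOrderedModule ℝ F] [HasSolidNorm F]

/-- A Banach lattice has the dual positive Schur property if its bounded disjoint positive
sequences are order bounded. -/
theorem dualPositiveSchur_of_orderBounded
    (h : ∀ φ : ℕ → F, (∀ n, 0 ≤ φ n) → DisjointSeq φ → NormBoundedSeq φ → OrderBoundedSeq φ) :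
    DualPositiveSchur F := by
  intro u hu0 hu
  by_contra hcon
  obtain ⟨ε, hε, φ, hφ, hn⟩ := exists_subseq_of_not_tendsto_zero (fun n => norm_nonneg _) hcon
  obtain ⟨K, hK⟩ := weakStarNull_bounded hu
  -- Disjointifying these almost norming vectors gives a sequence with an upper bound `b` on which
  -- `u` stays away from zero, while `u n b → 0`.
  choose x hx0 hx1 hx using fun n => exists_nonneg_half_norm_le (hu0 (φ n))
  obtain ⟨ψ, hψ, z, hzd, hz0, hzx, hz⟩ := exists_disjointSeq_of_tendsto hx0 hx1
    (fun n => hu0 (φ n)) (fun n => hK _) (half_pos hε)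
    (fun n => (div_le_div_of_nonneg_right (hn n) zero_le_two).trans (hx n))
    (fun i => (hu (x i)).comp hφ.tendsto_atTop)
  obtain ⟨_, b, hb⟩ := h z hz0 hzd ⟨1, fun n => (norm_le_norm_of_abs_le_abs
    (abs_le_abs_of_nonneg (hz0 n) (hzx n))).trans (hx1 _)⟩
  have h1 : ε / 2 / 2 ≤ 0 := ge_of_tendsto' ((hu b).comp (hφ.comp hψ).tendsto_atTop) fun n =>
    (hz n).trans (dual_mono (hu0 _) (hb n).2)
  linarith

end DualPositiveSchur

/-! ### From weakly positively limited to almost Dunford-Pettis -/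

section PositiveBilinear

theorem IsPositiveBilinear.norm_apply_le_norm_apply_abs {X Y Z : Type*}
    [AddCommGroup X] [Module ℝ X] [Lattice X] [IsOrderedAddMonoid X]
    [AddCommGroup Y] [Module ℝ Y] [Lattice Y] [IsOrderedAddMonoid Y]
    [NormedAddCommGroup Z] [NormedSpace ℝ Z] [Lattice Z] [IsOrderedAddMonoid Z] [HasSolidNorm Z]
    {A : X →ₗ[ℝ] Y →ₗ[ℝ] Z} (hA : IsPositiveBilinear A) (x : X) (y : Y) :
    ‖A x y‖ ≤ ‖A |x| |y|‖ := by
  apply norm_le_norm_of_abs_le_abs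
  have e1 := hA _ _ (posPart_nonneg x) (posPart_nonneg y)
  have e2 := hA _ _ (posPart_nonneg x) (negPart_nonneg y)
  have e3 := hA _ _ (negPart_nonneg x) (posPart_nonneg y)
  have e4 := hA _ _ (negPart_nonneg x) (negPart_nonneg y)
  have h1 : A x y = (A x⁺ y⁺ + A x⁻ y⁻) - (A x⁺ y⁻ + A x⁻ y⁺) := by
    conv_lhs => rw [← posPart_sub_negPart x, ← posPart_sub_negPart y]
    simp only [map_sub, LinearMap.sub_apply]
    abel
  have h2 : A |x| |y| = (A x⁺ y⁺ + A x⁻ y⁻) + (A x⁺ y⁻ + A x⁻ y⁺) := by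
    rw [← posPart_add_negPart x, ← posPart_add_negPart y]
    simp only [map_add, LinearMap.add_apply]
    abel
  rw [abs_of_nonneg (hA _ _ (abs_nonneg x) (abs_nonneg y)), h1, h2]
  have p1 := add_nonneg e1 e4
  have p2 := add_nonneg e2 e3
  refine abs_le'.2 ⟨?_, ?_⟩
  · exact (sub_le_self _ p2).trans (le_add_of_nonneg_right p2)
  · rw [neg_sub]
    exact (sub_le_self _ p1).trans (le_add_of_nonneg_left p1)

/-- A positive weakly positively limited operator on a product of biduals is almost
Dunford-Pettis. -/
theorem WeaklyPositivelyLimited.almostDunfordPettis {X Y Z : Type*}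
    [NormedAddCommGroup X] [NormedSpace ℝ X] [Lattice X] [IsOrderedAddMonoid X] [HasSolidNorm X]
    [CompleteSpace X] [NormedAddCommGroup Y] [NormedSpace ℝ Y] [Lattice Y] [IsOrderedAddMonoid Y]
    [HasSolidNorm Y] [CompleteSpace Y] [NormedAddCommGroup Z] [NormedSpace ℝ Z] [Lattice Z]
    [IsOrderedAddMonoid Z] [HasSolidNorm Z]
    {B : StrongDual ℝ X →ₗ[ℝ] StrongDual ℝ Y →ₗ[ℝ] Z} (hW : WeaklyPositivelyLimited B)
    (hB : IsPositiveBilinear B) : AlmostDunfordPettis B := by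
  intro x y hxd hx hyd hy
  have hx' : WeakStarNull fun n => |x n| := fun f =>
    hx.abs_of_disjoint hxd (NormedSpace.inclusionInDoubleDual ℝ X f)
  have hy' : WeakStarNull fun n => |y n| := fun f =>
    hy.abs_of_disjoint hyd (NormedSpace.inclusionInDoubleDual ℝ Y f)
  exact squeeze_zero (fun n => norm_nonneg _)
    (fun n => hB.norm_apply_le_norm_apply_abs (x n) (y n))
    (hW _ _ (fun n => abs_nonneg _) (fun n => abs_nonneg _)
      (Or.inl ⟨hx', weakStarNull_bounded hy'⟩))

end PositiveBilinear

/-! ### Extensions to the biduals -/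

section Extensions

/-- Evaluated at a fixed `φ`, each extension of `A` is one of the two iterated extensions of the
scalar form `arensAdjoint A φ`. -/
theorem aronBerner_cases {E₁ E₂ F : Type*} [NormedAddCommGroup E₁] [NormedSpace ℝ E₁]
    [NormedAddCommGroup E₂] [NormedSpace ℝ E₂] [NormedAddCommGroup F] [NormedSpace ℝ F]
    (A : E₁ →L[ℝ] E₂ →L[ℝ] F) (ρ : Equiv.Perm (Fin 2)) :
    (∀ u v φ, aronBerner ρ A u v φ = u (v.comp (arensAdjoint A φ))) ∨
      (∀ u v φ, aronBerner ρ A u v φ = v (u.comp (arensAdjoint A φ).flip)) := by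
  unfold aronBerner
  split_ifs
  · exact Or.inr fun u v φ => rfl
  · exact Or.inl fun u v φ => rfl

variable {E₁ E₂ F : Type*}
    [NormedAddCommGroup E₁] [NormedSpace ℝ E₁] [Lattice E₁]
    [IsOrderedAddMonoid E₁] [HasSolidNorm E₁]
    [NormedAddCommGroup E₂] [NormedSpace ℝ E₂] [Lattice E₂]
    [IsOrderedAddMonoid E₂] [HasSolidNorm E₂]
    [NormedAddCommGroup F] [NormedSpace ℝ F] [Lattice F]
    [IsOrderedAddMonoid F] [HasSolidNorm F]

theorem aronBerner_nonneg {A : E₁ →L[ℝ] E₂ →L[ℝ] F} (hA : ∀ x y, 0 ≤ x → 0 ≤ y → 0 ≤ A x y)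
    (ρ : Equiv.Perm (Fin 2)) {u : StrongDual ℝ (StrongDual ℝ E₁)}
    {v : StrongDual ℝ (StrongDual ℝ E₂)} (hu : 0 ≤ u) (hv : 0 ≤ v) : 0 ≤ aronBerner ρ A u v := by
  intro φ hφ
  rw [_root_.zero_apply]
  have ha : ∀ x y, 0 ≤ x → 0 ≤ y → 0 ≤ arensAdjoint A φ x y := fun x y hx hy => hφ _ (hA x y hx hy)
  rcases aronBerner_cases A ρ with h | h <;> rw [h]
  · exact hu _ fun x hx => hv _ fun y hy => ha x y hx hy
  · exact hv _ fun y hy => hu _ fun x hx => ha x y hx hy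

end Extensions

end BanachLattice

theorem theorem3p8 {E₁ E₂ F : Type*}
    [NormedAddCommGroup E₁] [NormedSpace ℝ E₁] [CompleteSpace E₁] [Lattice E₁]
    [IsOrderedAddMonoid E₁] [IsOrderedModule ℝ E₁] [HasSolidNorm E₁]
    [NormedAddCommGroup E₂] [NormedSpace ℝ E₂] [CompleteSpace E₂] [Lattice E₂]
    [IsOrderedAddMonoid E₂] [IsOrderedModule ℝ E₂] [HasSolidNorm E₂]
    [NormedAddCommGroup F] [NormedSpace ℝ F] [CompleteSpace F] [Lattice F]
    [IsOrderedAddMonoid F] [IsOrderedModule ℝ F] [HasSolidNorm F]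
    (hE₁ : OrderContinuousNorm (StrongDual ℝ E₁))
    (hE₂ : OrderContinuousNorm (StrongDual ℝ E₂))
    (A : E₁ →ₗ[ℝ] E₂ →ₗ[ℝ] F) (hA : IsPositiveBilinear A) (hADP : AlmostDunfordPettis A)
    (hF : DualPositiveSchur (StrongDual ℝ F) ∨
      ∀ φ : ℕ → StrongDual ℝ F, (∀ n, 0 ≤ φ n) → DisjointSeq φ → NormBoundedSeq φ →
        OrderBoundedSeq φ) :
    ∀ ρ : Equiv.Perm (Fin 2),
      WeaklyPositivelyLimited (aronBerner ρ hA.toContinuous).toLinearMap₁₂ ∧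
        AlmostDunfordPettis (aronBerner ρ hA.toContinuous).toLinearMap₁₂ := by
  intro ρ
  have hSchur : DualPositiveSchur (StrongDual ℝ F) := hF.elim id dualPositiveSchur_of_orderBounded
  have hpos : IsPositiveBilinear (aronBerner ρ hA.toContinuous).toLinearMap₁₂ :=
    fun u v hu hv => aronBerner_nonneg (A := hA.toContinuous) hA ρ hu hv
  have hW : WeaklyPositivelyLimited (aronBerner ρ hA.toContinuous).toLinearMap₁₂ := by
    intro u v hu hv huv
    -- Positivity of the values lets the Schur property upgrade weak* convergence to norm
    -- convergence; by splitting `φ`, positive functionals suffice.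
    refine hSchur _ (fun n => hpos _ _ (hu n) (hv n)) fun φ => ?_
    revert φ
    suffices h : ∀ φ : StrongDual ℝ F, 0 ≤ φ →
        Tendsto (fun n => aronBerner ρ hA.toContinuous (u n) (v n) φ) atTop (𝓝 0) by
      intro φ
      have h1 := (h φ⁺ (posPart_nonneg φ)).sub (h φ⁻ (negPart_nonneg φ))
      rw [sub_zero] at h1
      refine h1.congr fun n => ?_
      rw [← map_sub, posPart_sub_negPart]
      rfl
    intro φ hφ
    have hap : ∀ (x : ℕ → E₁) (y : ℕ → E₂), DisjointSeq x → WeaklyNull x → DisjointSeq y →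
        WeaklyNull y → Tendsto (fun n => φ (A (x n) (y n))) atTop (𝓝 0) :=
      fun x y hxd hx hyd hy => by
        have h1 := tendsto_zero_iff_norm_tendsto_zero.2 (hADP x y hxd hx hyd hy)
        have h2 := (φ.continuous.tendsto 0).comp h1
        rwa [map_zero] at h2
    have ha : ∀ x y, 0 ≤ x → 0 ≤ y → 0 ≤ φ (A x y) := fun x y hx hy => hφ _ (hA x y hx hy)
    set a := arensAdjoint hA.toContinuous φ with ha_def
    have key : Tendsto (fun n => u n ((v n).comp a)) atTop (𝓝 0) ∧
        Tendsto (fun n => v n ((u n).comp a.flip)) atTop (𝓝 0) := by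
      rcases huv with ⟨hun, hvb⟩ | ⟨hub, hvn⟩
      · exact tendsto_extensions_of_form hE₁ hE₂ (a := a) (fun x hx y hy => ha x y hx hy) hap
          hu hv hun hvb
      -- When `v` is the weak* null sequence, the two factors exchange roles: the form is flipped
      -- and the two limits come out in the opposite order.
      · exact (tendsto_extensions_of_form hE₂ hE₁ (a := a.flip)
          (fun y hy x hx => ha x y hx hy) (fun y x hyd hy hxd hx => hap x y hxd hx hyd hy)
          hv hu hvn hub).symm
    rcases aronBerner_cases hA.toContinuous ρ with h | h
    · simpa only [h] using key.1
    · simpa only [h] using key.2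
  exact ⟨hW, hW.almostDunfordPettis hpos⟩
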